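/- Let $n\ge 1$, let $\Omega\subset\mathbb{R}^n$ be open and let $f\in BV_{\mathrm{loc}}(\Omega)$, i.e. $f\in L^1_{\mathrm{loc}}(\Omega)$ and, for every open $V$ whose closure is compact and contained in $\Omega$, the total variation $$|Df|(V)=\sup\Big\{\int_V f\,\operatorname{div}\varphi\,dx:\ \varphi\in C^1_c(V;\mathbb{R}^n),\ \|\varphi\|_\infty\le 1\Big\}$$ is finite. Denote also by $|Df|$ the total variation measure of $f$, that is, the Borel measure on $\Omega$ given by $|Df|(B)=\inf\{|Df|(U): U \text{ open},\ B\subset U\subset\Omega\}$ for Borel sets $B\subset\Omega$. For an open set $U\subset\Omega$ and $\varepsilon>0$ let $$\mathsf G_\varepsilon(f,U)=\sup_{\mathcal H}\ \sum_{Q\in\mathcal H}\ell(Q)^{n-1}\,\frac{1}{|Q|}\int_Q\Big|f(x)-\frac{1}{|Q|}\int_Q f\Big|\,dx\ \in[0,\infty],$$ where the supremum is over all families $\mathcal H$ of pairwise disjoint open cubes $Q\subset U$, of arbitrary orientation and of sidelength $\ell(Q)\le\varepsilon$; the mean oscillation over $Q$ is $+\infty$ if $f$ is not integrable on $Q$.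 Let $$\mathsf G(f,U)=\lim_{\varepsilon\to0^+}\mathsf G_\varepsilon(f,U)\in[0,\infty],$$ which exists since $\mathsf G_\varepsilon(f,U)$ is nondecreasing in $\varepsilon$. Then the set function $U\mapsto\mathsf G(f,U)$ on the open subsets of $\Omega$ extends to a Radon measure $\mathsf G(f,\cdot)$ on $\Omega$, i.e. a regular Borel measure that is finite on compact subsets of $\Omega$, and this measure is absolutely continuous with respect to $|Df|$. In particular, there is a Borel function $g_f:\Omega\to[0,\infty)$ such that $$\mathsf G(f,B)=\int_B g_f(x)\,d|Df|(x)\qquad\text{for every Borel set } B\subset\Omega .$$ -/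

import Mathlib

open MeasureTheory Set Filter Topology
open scoped ENNReal NNReal

namespace BVOsc

/-- The divergence of a vector field `φ : ℝⁿ → ℝⁿ`. -/
noncomputable def divergence {n : ℕ}
    (φ : EuclideanSpace ℝ (Fin n) → EuclideanSpace ℝ (Fin n))
    (x : EuclideanSpace ℝ (Fin n)) : ℝ :=
  ∑ i : Fin n, (fderiv ℝ φ x (EuclideanSpace.single i 1)) i

/-- Admissible test fields for the variation in `U`: `φ ∈ C¹_c(U; ℝⁿ)` with `‖φ‖_∞ ≤ 1`
(Euclidean norm on `ℝⁿ`). -/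
structure IsTestField {n : ℕ} (U : Set (EuclideanSpace ℝ (Fin n)))
    (φ : EuclideanSpace ℝ (Fin n) → EuclideanSpace ℝ (Fin n)) : Prop where
  contDiff : ContDiff ℝ 1 φ
  hasCompactSupport : HasCompactSupport φ
  tsupport_subset : tsupport φ ⊆ U
  norm_le_one : ∀ x, ‖φ x‖ ≤ 1

/-- The total variation of `f` in the open set `U`,
`sup { ∫_U f div φ : φ ∈ C¹_c(U; ℝⁿ), ‖φ‖_∞ ≤ 1 } ∈ [0, ∞]`. -/
noncomputable def variation {n : ℕ} (f : EuclideanSpace ℝ (Fin n) → ℝ)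
    (U : Set (EuclideanSpace ℝ (Fin n))) : ℝ≥0∞ :=
  ⨆ (φ : EuclideanSpace ℝ (Fin n) → EuclideanSpace ℝ (Fin n)) (_ : IsTestField U φ),
    ENNReal.ofReal (∫ x in U, f x * divergence φ x)

/-- `f ∈ BV_loc(Ω)`: `f` is locally integrable in `Ω` and its total variation is finite in every
open set `V` that is relatively compact in `Ω`. -/
structure IsBVLoc {n : ℕ} (f : EuclideanSpace ℝ (Fin n) → ℝ)
    (Ω : Set (EuclideanSpace ℝ (Fin n))) : Prop where
  locallyIntegrableOn : LocallyIntegrableOn f Ω volume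
  variation_lt_top : ∀ V : Set (EuclideanSpace ℝ (Fin n)), IsOpen V → IsCompact (closure V) →
    closure V ⊆ Ω → variation f V < ∞

theorem divergence_eq_zero {n : ℕ}
    {φ : EuclideanSpace ℝ (Fin n) → EuclideanSpace ℝ (Fin n)}
    {x : EuclideanSpace ℝ (Fin n)} (hx : x ∉ tsupport φ) : divergence φ x = 0 := by
  have h : fderiv ℝ φ x = 0 := by
    by_contra hne
    exact hx (support_fderiv_subset ℝ (Function.mem_support.2 hne))
  simp [divergence, h]

theorem setIntegral_test {n : ℕ} (f : EuclideanSpace ℝ (Fin n) → ℝ)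
    {U : Set (EuclideanSpace ℝ (Fin n))}
    {φ : EuclideanSpace ℝ (Fin n) → EuclideanSpace ℝ (Fin n)} (h : tsupport φ ⊆ U) :
    ∫ x in U, f x * divergence φ x = ∫ x, f x * divergence φ x := by
  apply setIntegral_eq_integral_of_forall_compl_eq_zero
  intro x hx
  rw [divergence_eq_zero (fun hx' => hx (h hx')), mul_zero]

theorem variation_empty {n : ℕ} (f : EuclideanSpace ℝ (Fin n) → ℝ) : variation f ∅ = 0 := by
  simp [variation]

theorem isTestField_zero {n : ℕ} (U : Set (EuclideanSpace ℝ (Fin n))) : IsTestField U 0 :=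
  ⟨contDiff_const, HasCompactSupport.zero, by simp [tsupport], by simp⟩

theorem exists_integrable_test {n : ℕ} (f : EuclideanSpace ℝ (Fin n) → ℝ)
    {U : Set (EuclideanSpace ℝ (Fin n))}
    {φ : EuclideanSpace ℝ (Fin n) → EuclideanSpace ℝ (Fin n)} (h : IsTestField U φ) :
    ∃ ψ, IsTestField U ψ ∧ Integrable (fun x => f x * divergence ψ x) ∧
      ENNReal.ofReal (∫ x in U, f x * divergence φ x) ≤
        ENNReal.ofReal (∫ x, f x * divergence ψ x) ∧ 0 ≤ ∫ x, f x * divergence ψ x := by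
  rw [setIntegral_test f h.tsupport_subset]
  have hdiv0 : ∀ x, divergence (0 : EuclideanSpace ℝ (Fin n) → EuclideanSpace ℝ (Fin n)) x = 0 :=
    fun x => by simp [divergence]
  by_cases hi : Integrable (fun x => f x * divergence φ x) ∧ 0 ≤ ∫ x, f x * divergence φ x
  · exact ⟨φ, h, hi.1, le_rfl, hi.2⟩
  · refine ⟨0, isTestField_zero U, by simp [hdiv0], ?_, by simp [hdiv0]⟩
    have : ∫ x, f x * divergence φ x ≤ 0 := by
      by_cases h1 : Integrable (fun x => f x * divergence φ x)
      · exact le_of_not_ge fun h2 => hi ⟨h1, h2⟩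
      · rw [integral_undef h1]
    rw [ENNReal.ofReal_of_nonpos this]
    exact zero_le

theorem IsTestField.add {n : ℕ} {U W O : Set (EuclideanSpace ℝ (Fin n))}
    {φ ψ : EuclideanSpace ℝ (Fin n) → EuclideanSpace ℝ (Fin n)} (hφ : IsTestField U φ)
    (hψ : IsTestField W ψ) (hd : Disjoint U W) (hU : U ⊆ O) (hW : W ⊆ O) :
    IsTestField O (φ + ψ) := by
  refine ⟨hφ.contDiff.add hψ.contDiff, hφ.hasCompactSupport.add hψ.hasCompactSupport, ?_, ?_⟩
  · exact (tsupport_add φ ψ).trans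
      (union_subset (hφ.tsupport_subset.trans hU) (hψ.tsupport_subset.trans hW))
  · intro x
    by_cases hx : x ∈ U
    · have : ψ x = 0 := image_eq_zero_of_notMem_tsupport fun h =>
        Set.disjoint_left.1 hd hx (hψ.tsupport_subset h)
      simpa [this] using hφ.norm_le_one x
    · have : φ x = 0 := image_eq_zero_of_notMem_tsupport fun h => hx (hφ.tsupport_subset h)
      simpa [this] using hψ.norm_le_one x

theorem variation_superadd {n : ℕ} (f : EuclideanSpace ℝ (Fin n) → ℝ)
    {U W O : Set (EuclideanSpace ℝ (Fin n))} (hd : Disjoint U W) (hU : U ⊆ O) (hW : W ⊆ O) :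
    variation f U + variation f W ≤ variation f O := by
  have key : ∀ φ ψ, IsTestField U φ → IsTestField W ψ →
      ENNReal.ofReal (∫ x in U, f x * divergence φ x) +
        ENNReal.ofReal (∫ x in W, f x * divergence ψ x) ≤ variation f O := by
    intro φ ψ hφ hψ
    obtain ⟨φ', hφ', iφ, leφ, pφ⟩ := exists_integrable_test f hφ
    obtain ⟨ψ', hψ', iψ, leψ, pψ⟩ := exists_integrable_test f hψ
    have ht := hφ'.add hψ' hd hU hW
    have hdiv : ∀ x, divergence (φ' + ψ') x = divergence φ' x + divergence ψ' x := by
      intro x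
      have h1 := (hφ'.contDiff.differentiable one_ne_zero) x
      have h2 := (hψ'.contDiff.differentiable one_ne_zero) x
      simp [divergence, fderiv_add h1 h2, Finset.sum_add_distrib]
    calc _ ≤ ENNReal.ofReal (∫ x, f x * divergence φ' x) +
          ENNReal.ofReal (∫ x, f x * divergence ψ' x) := add_le_add leφ leψ
      _ = ENNReal.ofReal (∫ x in O, f x * divergence (φ' + ψ') x) := by
          rw [setIntegral_test f ht.tsupport_subset, ← ENNReal.ofReal_add pφ pψ,
            ← integral_add iφ iψ]
          simp only [hdiv, mul_add]
      _ ≤ variation f O := le_iSup₂_of_le (φ' + ψ') ht le_rfl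
  rw [variation, variation]
  simp only [iSup_subtype']
  have : Nonempty {φ // IsTestField U φ} := ⟨⟨0, isTestField_zero U⟩⟩
  have : Nonempty {φ // IsTestField W φ} := ⟨⟨0, isTestField_zero W⟩⟩
  exact ENNReal.iSup_add_iSup_le fun φ ψ => key φ.1 ψ.1 φ.2 ψ.2

/-- The outer measure on `Ω` generated by the variation on the relatively open subsets of `Ω`,
`B ↦ inf { ∑ᵢ variation f Uᵢ : Uᵢ open, B ⊆ ⋃ᵢ Uᵢ }` (countable covers).  The total variation is
countably subadditive on open sets, hence this equals `inf { variation f U : U open, B ⊆ U }`. -/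
noncomputable def totalVarOuter {n : ℕ} (f : EuclideanSpace ℝ (Fin n) → ℝ)
    (Ω : Set (EuclideanSpace ℝ (Fin n))) : OuterMeasure Ω :=
  inducedOuterMeasure (fun (U : Set Ω) (_ : IsOpen U) => variation f (Subtype.val '' U))
    isOpen_empty (by simp [variation_empty])

theorem totalVarOuter_isMetric {n : ℕ} (f : EuclideanSpace ℝ (Fin n) → ℝ)
    (Ω : Set (EuclideanSpace ℝ (Fin n))) : (totalVarOuter f Ω).IsMetric := by
  intro s t hst
  refine le_antisymm (measure_union_le s t) ?_
  obtain ⟨r, r0, hr⟩ := hst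
  have hr2 : 0 < r / 2 := ENNReal.half_pos r0
  set S : Set Ω := ⋃ x ∈ s, Metric.eball x (r / 2) with hS
  set T : Set Ω := ⋃ x ∈ t, Metric.eball x (r / 2) with hT
  have hSo : IsOpen S := isOpen_biUnion fun _ _ => Metric.isOpen_eball
  have hTo : IsOpen T := isOpen_biUnion fun _ _ => Metric.isOpen_eball
  have hsS : s ⊆ S := fun x hx => mem_biUnion hx (Metric.mem_eball_self hr2)
  have htT : t ⊆ T := fun x hx => mem_biUnion hx (Metric.mem_eball_self hr2)
  have hdis : Disjoint S T := by
    rw [Set.disjoint_left]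
    intro z hz hz'
    obtain ⟨x, hx, hxz⟩ := mem_iUnion₂.1 hz
    obtain ⟨y, hy, hyz⟩ := mem_iUnion₂.1 hz'
    rw [Metric.mem_eball] at hxz hyz
    have : edist x y < r := by
      calc edist x y ≤ edist x z + edist z y := edist_triangle _ _ _
        _ < r / 2 + r / 2 := ENNReal.add_lt_add (by rwa [edist_comm]) hyz
        _ = r := ENNReal.add_halves r
    exact absurd (hr x hx y hy) (not_le.2 this)
  conv_rhs => rw [totalVarOuter, inducedOuterMeasure, OuterMeasure.ofFunction_apply]
  refine le_iInf₂ fun O hO => ?_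
  by_cases hOo : ∀ i, IsOpen (O i)
  · have hle : ∀ A : Set Ω, IsOpen A → totalVarOuter f Ω A ≤ variation f (Subtype.val '' A) :=
      fun A hA => le_inducedOuterMeasure.1 le_rfl A hA
    have h1 : ∀ (A B : Set Ω), IsOpen B → A ⊆ B → A ⊆ ⋃ i, O i →
        totalVarOuter f Ω A ≤ ∑' i, variation f (Subtype.val '' (O i ∩ B)) := by
      intro A B hB hAB hAO
      have hsub : A ⊆ ⋃ i, O i ∩ B := by
        rw [← iUnion_inter]
        exact subset_inter hAO hAB
      exact (measure_mono hsub).trans ((measure_iUnion_le _).trans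
        (ENNReal.tsum_le_tsum fun i => hle _ ((hOo i).inter hB)))
    calc _ ≤ (∑' i, variation f (Subtype.val '' (O i ∩ S))) +
          ∑' i, variation f (Subtype.val '' (O i ∩ T)) :=
          add_le_add (h1 s S hSo hsS (subset_union_left.trans hO))
            (h1 t T hTo htT (subset_union_right.trans hO))
      _ = ∑' i, (variation f (Subtype.val '' (O i ∩ S)) +
          variation f (Subtype.val '' (O i ∩ T))) := ENNReal.tsum_add.symm
      _ ≤ _ := by
          refine ENNReal.tsum_le_tsum fun i => ?_
          rw [extend_eq _ (hOo i)]
          refine variation_superadd f ?_ (image_mono inter_subset_left)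
            (image_mono inter_subset_left)
          rw [disjoint_image_iff Subtype.val_injective]
          exact hdis.mono inter_subset_right inter_subset_right
  · obtain ⟨i, hi⟩ := not_forall.1 hOo
    refine le_top.trans (top_le_iff.2 ?_).ge
    refine ENNReal.tsum_eq_top_of_eq_top ⟨i, ?_⟩
    exact extend_eq_top _ hi

/-- The total variation measure `|Df|` of `f`, as a Borel measure on `Ω`. -/
noncomputable def totalVar {n : ℕ} (f : EuclideanSpace ℝ (Fin n) → ℝ)
    (Ω : Set (EuclideanSpace ℝ (Fin n))) : Measure Ω :=
  (totalVarOuter f Ω).toMeasure (totalVarOuter_isMetric f Ω).le_caratheodory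

/-- Data of an open cube in `ℝⁿ` of arbitrary orientation: its center, its sidelength and a linear
isometry that sends the directions of its edges to the coordinate directions. -/
structure Cube (n : ℕ) where
  center : EuclideanSpace ℝ (Fin n)
  side : ℝ
  side_pos : 0 < side
  frame : EuclideanSpace ℝ (Fin n) ≃ₗᵢ[ℝ] EuclideanSpace ℝ (Fin n)

/-- The open cube as a set of points. -/
def Cube.carrier {n : ℕ} (Q : Cube n) : Set (EuclideanSpace ℝ (Fin n)) :=
  {x | ∀ i : Fin n, |(Q.frame (x - Q.center)) i| < Q.side / 2}

/-- The mean oscillation `⨍_Q |f - ⨍_Q f|` of `f` over `Q`, as an element of `[0, ∞]`.  If `f` is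
locally integrable in the open set `Q` but not integrable over `Q`, its value is `∞`. -/
noncomputable def osc {n : ℕ} (f : EuclideanSpace ℝ (Fin n) → ℝ)
    (Q : Set (EuclideanSpace ℝ (Fin n))) : ℝ≥0∞ :=
  ⨍⁻ x in Q, ‖f x - ⨍ y in Q, f y ∂volume‖ₑ ∂volume

/-- `H` is a family of pairwise disjoint open cubes contained in `U`, of sidelength at most `ε`.
(Each cube occurs at most once, whatever the choice of `frame`, since cubes are nonempty.) -/
structure IsAdmissible {n : ℕ} (ε : ℝ) (U : Set (EuclideanSpace ℝ (Fin n)))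
    (H : Set (Cube n)) : Prop where
  disjoint : H.PairwiseDisjoint Cube.carrier
  side_le : ∀ Q ∈ H, Q.side ≤ ε
  subset : ∀ Q ∈ H, Q.carrier ⊆ U

/-- `G_ε(f, U) = sup ∑_{Q ∈ H} ℓ(Q)^{n-1} Osc(f, Q)`, the supremum over all admissible `H`. -/
noncomputable def Geps {n : ℕ} (ε : ℝ) (f : EuclideanSpace ℝ (Fin n) → ℝ)
    (U : Set (EuclideanSpace ℝ (Fin n))) : ℝ≥0∞ :=
  ⨆ (H : Set (Cube n)) (_ : IsAdmissible ε U H),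
    ∑' Q : H, ENNReal.ofReal (Q : Cube n).side ^ (n - 1) * osc f (Q : Cube n).carrier

theorem Geps_mono {n : ℕ} (f : EuclideanSpace ℝ (Fin n) → ℝ)
    (U : Set (EuclideanSpace ℝ (Fin n))) : Monotone fun ε => Geps ε f U := by
  intro ε δ h
  exact iSup₂_le fun H hH =>
    le_iSup₂_of_le H ⟨hH.disjoint, fun Q hQ => (hH.side_le Q hQ).trans h, hH.subset⟩ le_rfl

/-- `G(f, U) = lim_{ε → 0⁺} G_ε(f, U)`; as `G_ε(f, U)` is nondecreasing in `ε`, the limit is the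
infimum over `ε > 0`, see `tendsto_Geps`. -/
noncomputable def G {n : ℕ} (f : EuclideanSpace ℝ (Fin n) → ℝ)
    (U : Set (EuclideanSpace ℝ (Fin n))) : ℝ≥0∞ :=
  ⨅ (ε : ℝ) (_ : 0 < ε), Geps ε f U

theorem tendsto_Geps {n : ℕ} (f : EuclideanSpace ℝ (Fin n) → ℝ)
    (U : Set (EuclideanSpace ℝ (Fin n))) :
    Tendsto (fun ε => Geps ε f U) (𝓝[>] 0) (𝓝 (G f U)) := by
  have h := (Geps_mono f U).tendsto_nhdsGT 0
  rwa [sInf_image] at h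

end BVOsc

/-! Superadditivity of `G` on disjoint open sets comes from the definition, by uniting families of
cubes. The difficulty is countable subadditivity, and it rests on a two-sided comparison of `G` with
the variation on open sets. Upper bound: the Poincaré inequality on cubes (`side_pow_mul_osc_le`),
summed over a disjoint family, gives `G ≤ C |Df|`. Lower bound (`variation_le_G`): the cubes of
sidelength `4h` around the cells of a grid of mesh `h` split into `4 ^ n` disjoint families, so the
`L¹` size of `f(· - h eⱼ) - f` on a compact set is at most a constant times `h * Geps (4 * h)`;
letting `h → 0` bounds `∫ f ∂ⱼψ`. In a relatively compact open set a small cube lies in a single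
member of a given open cover (Lebesgue number), so subadditivity holds there. General open sets need
inner regularity, `G_le_of_forall_relcompact`. If `|Df|(U)` is finite, what remains outside a large
compact subset carries little variation, hence little `G`. If it is infinite, the lower bound makes
`G` unbounded along relatively compact subsets. Thus `G` generates a metric outer measure that
agrees with it on open sets. The upper bound passes to the measures and yields absolute continuity
and local finiteness, and Radon–Nikodym provides the density. -/

namespace BVOsc

variable {n : ℕ}

/-! ### Geometry of cubes -/

theorem Cube.center_mem (Q : Cube n) : Q.center ∈ Q.carrier := by
  intro i
  simpa using half_pos Q.side_pos

theorem Cube.nonempty (Q : Cube n) : Q.carrier.Nonempty := ⟨_, Q.center_mem⟩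

/-- Triangle inequality over the coordinates. The factor `n` is not sharp, but any bound of a cube's
diameter by its sidelength suffices. -/
theorem norm_le_of_abs_coord_le {v : EuclideanSpace ℝ (Fin n)} {c : ℝ} (h : ∀ i, |v i| ≤ c) :
    ‖v‖ ≤ n * c := by
  have h0 : v = ∑ i, v i • EuclideanSpace.single i (1 : ℝ) := by
    ext j
    simp [Finset.sum_apply, Pi.single_apply]
  calc ‖v‖ ≤ ∑ i : Fin n, ‖v i • EuclideanSpace.single i (1 : ℝ)‖ := by
        conv_lhs => rw [h0]
        exact norm_sum_le _ _
    _ ≤ ∑ _i : Fin n, c := Finset.sum_le_sum fun i _ => by simpa [norm_smul] using h i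
    _ = n * c := by simp

theorem Cube.dist_le (Q : Cube n) {x y : EuclideanSpace ℝ (Fin n)} (hx : x ∈ Q.carrier)
    (hy : y ∈ Q.carrier) : dist x y ≤ n * Q.side := by
  rw [dist_eq_norm, ← Q.frame.norm_map]
  refine norm_le_of_abs_coord_le fun i => ?_
  have h1 := hx i
  have h2 := hy i
  have : Q.frame (x - y) = Q.frame (x - Q.center) - Q.frame (y - Q.center) := by
    rw [← map_sub]; congr 1; abel
  rw [this, PiLp.sub_apply]
  exact (abs_sub _ _).trans (by linarith)

theorem Cube.carrier_eq_preimage (Q : Cube n) : Q.carrier =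
    (fun x => (Q.frame (x - Q.center)).ofLp) ⁻¹'
      (univ.pi fun _ => Ioo (-(Q.side / 2)) (Q.side / 2)) := by
  ext x
  simp [Cube.carrier, abs_lt]

theorem Cube.isOpen (Q : Cube n) : IsOpen Q.carrier := by
  rw [Q.carrier_eq_preimage]
  refine IsOpen.preimage (by fun_prop) (isOpen_set_pi finite_univ fun _ _ => isOpen_Ioo)

theorem Cube.convex (Q : Cube n) : Convex ℝ Q.carrier := by
  intro x hx y hy a b ha hb hab i
  have h : Q.frame (a • x + b • y - Q.center) =
      a • Q.frame (x - Q.center) + b • Q.frame (y - Q.center) := by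
    rw [← map_smul, ← map_smul, ← map_add]
    congr 1
    have : Q.center = (a + b) • Q.center := by rw [hab, one_smul]
    conv_lhs => rw [this]
    module
  have h1 := abs_lt.1 (hx i)
  have h2 := abs_lt.1 (hy i)
  rw [h]
  simp only [PiLp.add_apply, PiLp.smul_apply, smul_eq_mul]
  have hs := convex_Ioo (-(Q.side / 2)) (Q.side / 2) (x := (Q.frame (x - Q.center)) i)
    (y := (Q.frame (y - Q.center)) i) h1 h2 ha hb hab
  exact abs_lt.2 hs

theorem Cube.volume_carrier (Q : Cube n) :
    volume Q.carrier = ENNReal.ofReal Q.side ^ n := by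
  have hmp : MeasurePreserving (fun x : EuclideanSpace ℝ (Fin n) =>
      (Q.frame (x - Q.center)).ofLp) volume volume :=
    (PiLp.volume_preserving_ofLp (Fin n)).comp
      (Q.frame.measurePreserving.comp (measurePreserving_sub_right volume Q.center))
  rw [Q.carrier_eq_preimage, hmp.measure_preimage
    (MeasurableSet.univ_pi fun _ => measurableSet_Ioo).nullMeasurableSet, Real.volume_pi_Ioo]
  simp

theorem Cube.volume_ne_zero (Q : Cube n) : volume Q.carrier ≠ 0 := by
  rw [Q.volume_carrier]
  exact pow_ne_zero _ (by simpa using Q.side_pos)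

theorem Cube.volume_ne_top (Q : Cube n) : volume Q.carrier ≠ ∞ := by
  rw [Q.volume_carrier]
  exact ENNReal.pow_ne_top ENNReal.ofReal_ne_top

/-! ### Monotonicity, superadditivity and finite subadditivity of `G` -/

theorem Geps_mono_set (ε : ℝ) (f : EuclideanSpace ℝ (Fin n) → ℝ)
    {U W : Set (EuclideanSpace ℝ (Fin n))} (h : U ⊆ W) : Geps ε f U ≤ Geps ε f W :=
  iSup₂_le fun H hH =>
    le_iSup₂_of_le H ⟨hH.disjoint, hH.side_le, fun Q hQ => (hH.subset Q hQ).trans h⟩ le_rfl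

theorem G_mono (f : EuclideanSpace ℝ (Fin n) → ℝ)
    {U W : Set (EuclideanSpace ℝ (Fin n))} (h : U ⊆ W) : G f U ≤ G f W :=
  iInf₂_mono fun ε _ => Geps_mono_set ε f h

/-- Disjoint nonempty cubes are distinct, so `Q` is injective and the sum equals the sum over its
range. Sums over disjoint unions and over fibres can then be compared with `Geps` directly. -/
theorem tsum_le_Geps {ι : Type*} {ε : ℝ} (f : EuclideanSpace ℝ (Fin n) → ℝ)
    {U : Set (EuclideanSpace ℝ (Fin n))} (Q : ι → Cube n)
    (hd : Pairwise fun i j => Disjoint (Q i).carrier (Q j).carrier)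
    (hs : ∀ i, (Q i).side ≤ ε) (hU : ∀ i, (Q i).carrier ⊆ U) :
    ∑' i, ENNReal.ofReal (Q i).side ^ (n - 1) * osc f (Q i).carrier ≤ Geps ε f U := by
  have hinj : Function.Injective Q := by
    intro i j hij
    by_contra hne
    have : Disjoint (Q i).carrier (Q j).carrier := hd hne
    rw [hij, disjoint_self] at this
    exact (Q j).nonempty.ne_empty this
  refine le_iSup₂_of_le (range Q) ⟨?_, ?_, ?_⟩ ?_
  · rintro _ ⟨i, rfl⟩ _ ⟨j, rfl⟩ hne
    exact hd fun h => hne (by rw [h])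
  · rintro _ ⟨i, rfl⟩
    exact hs i
  · rintro _ ⟨i, rfl⟩
    exact hU i
  · rw [tsum_range (g := Q)
      (f := fun Q : Cube n => ENNReal.ofReal Q.side ^ (n - 1) * osc f Q.carrier) hinj]

theorem Geps_superadd (ε : ℝ) (f : EuclideanSpace ℝ (Fin n) → ℝ)
    {U W O : Set (EuclideanSpace ℝ (Fin n))} (hd : Disjoint U W) (hU : U ⊆ O) (hW : W ⊆ O) :
    Geps ε f U + Geps ε f W ≤ Geps ε f O := by
  have key : ∀ H K, IsAdmissible ε U H → IsAdmissible ε W K →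
      (∑' Q : H, ENNReal.ofReal (Q : Cube n).side ^ (n - 1) * osc f (Q : Cube n).carrier) +
      (∑' Q : K, ENNReal.ofReal (Q : Cube n).side ^ (n - 1) * osc f (Q : Cube n).carrier) ≤
        Geps ε f O := by
    intro H K hH hK
    refine (ENNReal.summable.tsum_sum (f := fun x : H ⊕ K =>
      ENNReal.ofReal (Sum.elim (fun Q : H => (Q : Cube n)) (fun Q : K => (Q : Cube n)) x).side
        ^ (n - 1) * osc f (Sum.elim (fun Q : H => (Q : Cube n))
          (fun Q : K => (Q : Cube n)) x).carrier) ENNReal.summable).symm.le.trans ?_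
    refine tsum_le_Geps f _ ?_ ?_ ?_
    · have hHK : ∀ (Q : H) (R : K), Disjoint (Q : Cube n).carrier (R : Cube n).carrier :=
        fun Q R => hd.mono (hH.subset _ Q.2) (hK.subset _ R.2)
      rintro (Q | Q) (R | R) hne
      · exact hH.disjoint Q.2 R.2 fun h => hne (by rw [Subtype.ext h])
      · exact hHK Q R
      · exact (hHK R Q).symm
      · exact hK.disjoint Q.2 R.2 fun h => hne (by rw [Subtype.ext h])
    · rintro (Q | Q)
      · exact hH.side_le _ Q.2
      · exact hK.side_le _ Q.2
    · rintro (Q | Q)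
      · exact (hH.subset _ Q.2).trans hU
      · exact (hK.subset _ Q.2).trans hW
  have hempty : ∀ V : Set (EuclideanSpace ℝ (Fin n)), IsAdmissible ε V ∅ :=
    fun V => ⟨by simp, by simp, by simp⟩
  rw [Geps, Geps]
  simp only [iSup_subtype']
  have : Nonempty {H // IsAdmissible ε U H} := ⟨⟨∅, hempty U⟩⟩
  have : Nonempty {H // IsAdmissible ε W H} := ⟨⟨∅, hempty W⟩⟩
  exact ENNReal.iSup_add_iSup_le fun H K => key H.1 K.1 H.2 K.2

theorem G_superadd (f : EuclideanSpace ℝ (Fin n) → ℝ)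
    {U W O : Set (EuclideanSpace ℝ (Fin n))} (hd : Disjoint U W) (hU : U ⊆ O) (hW : W ⊆ O) :
    G f U + G f W ≤ G f O :=
  le_of_tendsto_of_tendsto' ((tendsto_Geps f U).add (tendsto_Geps f W)) (tendsto_Geps f O)
    fun ε => Geps_superadd ε f hd hU hW

theorem Geps_empty (ε : ℝ) (f : EuclideanSpace ℝ (Fin n) → ℝ) : Geps ε f ∅ = 0 := by
  refine le_antisymm (iSup₂_le fun H hH => ?_) zero_le
  have : H = ∅ := by
    refine eq_empty_of_forall_notMem fun Q hQ => ?_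
    exact hH.subset Q hQ Q.center_mem
  subst this
  simp

theorem G_empty (f : EuclideanSpace ℝ (Fin n) → ℝ) : G f ∅ = 0 :=
  le_antisymm (iInf₂_le_of_le 1 one_pos (Geps_empty 1 f).le) zero_le

/-- If every cube of small sidelength in `U` is contained in one of finitely many sets `V i`, then
`G_ε` is subadditive for that cover. -/
theorem Geps_le_sum {ι : Type*} {ε : ℝ} (f : EuclideanSpace ℝ (Fin n) → ℝ)
    {U : Set (EuclideanSpace ℝ (Fin n))} (t : Finset ι)
    (V : ι → Set (EuclideanSpace ℝ (Fin n)))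
    (h : ∀ Q : Cube n, Q.side ≤ ε → Q.carrier ⊆ U → ∃ i ∈ t, Q.carrier ⊆ V i) :
    Geps ε f U ≤ ∑ i ∈ t, Geps ε f (V i) := by
  refine iSup₂_le fun H hH => ?_
  have h' : ∀ Q : H, ∃ i : t, (Q : Cube n).carrier ⊆ V i := fun Q => by
    obtain ⟨i, hi, hQ⟩ := h Q (hH.side_le _ Q.2) (hH.subset _ Q.2)
    exact ⟨⟨i, hi⟩, hQ⟩
  -- Each cube is charged to one `V i` only; the fibres of `c` are admissible families in the
  -- respective sets.
  choose c hc using h'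
  rw [← (Equiv.sigmaFiberEquiv c).tsum_eq, ← Finset.tsum_subtype]
  refine (ENNReal.tsum_sigma (f := fun i (Q : {Q : H // c Q = i}) =>
    ENNReal.ofReal (Q.1 : Cube n).side ^ (n - 1) * osc f (Q.1 : Cube n).carrier)).le.trans ?_
  refine ENNReal.tsum_le_tsum fun i => ?_
  refine tsum_le_Geps f (fun Q : {Q : H // c Q = i} => (Q.1 : Cube n)) ?_ ?_ ?_
  · intro Q R hne
    exact hH.disjoint Q.1.2 R.1.2 fun h => hne (Subtype.ext (Subtype.ext h))
  · exact fun Q => hH.side_le _ Q.1.2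
  · rintro ⟨Q, rfl⟩
    exact hc Q

theorem G_le_sum {ι : Type*} {ε : ℝ} (hε : 0 < ε) (f : EuclideanSpace ℝ (Fin n) → ℝ)
    {U : Set (EuclideanSpace ℝ (Fin n))} (t : Finset ι)
    (V : ι → Set (EuclideanSpace ℝ (Fin n)))
    (h : ∀ Q : Cube n, Q.side ≤ ε → Q.carrier ⊆ U → ∃ i ∈ t, Q.carrier ⊆ V i) :
    G f U ≤ ∑ i ∈ t, G f (V i) := by
  refine le_of_tendsto_of_tendsto (tendsto_Geps f U)
    (tendsto_finsetSum t fun i _ => tendsto_Geps f (V i)) ?_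
  filter_upwards [Ioc_mem_nhdsGT hε] with δ hδ
  exact Geps_le_sum f t V fun Q hQ => h Q (hQ.trans hδ.2)

/-- `G` of an open set which is relatively compact in a union is at most the sum of the `G`s. -/
theorem G_le_tsum_of_closure_subset {ι : Type*} (f : EuclideanSpace ℝ (Fin n) → ℝ)
    {U : Set (EuclideanSpace ℝ (Fin n))} (hc : IsCompact (closure U))
    (V : ι → Set (EuclideanSpace ℝ (Fin n))) (hV : ∀ i, IsOpen (V i))
    (hU : closure U ⊆ ⋃ i, V i) : G f U ≤ ∑' i, G f (V i) := by
  obtain ⟨t, ht⟩ := hc.elim_finite_subcover V hV hU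
  have ht' : closure U ⊆ ⋃ i : t, V i := by
    simpa [iUnion_subtype] using ht
  obtain ⟨δ, hδ, hδ'⟩ := lebesgue_number_lemma_of_metric hc (fun i : t => hV i) ht'
  -- Dividing by `n + 1` covers `n = 0` and makes the diameter bound `n * Q.side < δ` strict.
  have hn : (0 : ℝ) < n + 1 := by positivity
  refine (G_le_sum (div_pos hδ hn) f t V ?_).trans (ENNReal.sum_le_tsum t)
  intro Q hQ hQU
  obtain ⟨i, hi⟩ := hδ' Q.center (subset_closure (hQU Q.center_mem))
  refine ⟨i, i.2, fun x hx => hi ?_⟩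
  rw [Metric.mem_ball]
  refine (Q.dist_le hx Q.center_mem).trans_lt ?_
  rw [le_div_iff₀ hn] at hQ
  nlinarith [Q.side_pos]

/-! ### Testing against smooth functions and `L¹` duality -/

theorem integrable_mul_of_tsupport_subset {f g : EuclideanSpace ℝ (Fin n) → ℝ}
    {U : Set (EuclideanSpace ℝ (Fin n))} (hf : LocallyIntegrableOn f U volume)
    (hg : Continuous g) (hc : HasCompactSupport g) (hU : tsupport g ⊆ U) :
    Integrable fun x => f x * g x := by
  have h1 : IntegrableOn f (tsupport g) volume :=
    hf.integrableOn_compact_subset hU hc.isCompact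
  have h2 := h1.mul_continuousOn hg.continuousOn hc.isCompact
  refine (integrableOn_iff_integrable_of_support_subset fun x hx => ?_).1 h2
  exact subset_tsupport g (right_ne_zero_of_mul hx)

theorem exists_isCompact_exhaustion {U : Set (EuclideanSpace ℝ (Fin n))} (hU : IsOpen U) :
    ∃ F : ℕ → Set (EuclideanSpace ℝ (Fin n)), (∀ k, IsCompact (F k)) ∧ (∀ k, F k ⊆ U) ∧
      ⋃ k, F k = U ∧ Monotone F := by
  obtain ⟨F, hF, hFU, hFe, hFm⟩ := hU.exists_iUnion_isClosed
  refine ⟨fun k => F k ∩ Metric.closedBall 0 k,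
    fun k => (isCompact_closedBall _ _).inter_left (hF k),
    fun k => inter_subset_left.trans (hFU k), ?_, ?_⟩
  · refine subset_antisymm (iUnion_subset fun k => inter_subset_left.trans (hFU k)) fun x hx => ?_
    rw [← hFe] at hx
    obtain ⟨k, hk⟩ := mem_iUnion.1 hx
    obtain ⟨m, hm⟩ := exists_nat_ge ‖x‖
    refine mem_iUnion.2 ⟨max k m, hFm (le_max_left _ _) hk, ?_⟩
    rw [mem_closedBall_zero_iff]
    exact hm.trans (by exact_mod_cast le_max_right k m)
  · intro k m hkm
    refine inter_subset_inter (hFm hkm) (Metric.closedBall_subset_closedBall ?_)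
    exact_mod_cast hkm

open scoped Convolution in
/-- Smooth approximation of bounded functions which vanish outside of a compact set. -/
theorem exists_smooth_approx {U K : Set (EuclideanSpace ℝ (Fin n))} (hU : IsOpen U)
    (hK : IsCompact K) (hKU : K ⊆ U) {s : EuclideanSpace ℝ (Fin n) → ℝ}
    (hs : AEStronglyMeasurable s volume) (hs1 : ∀ x, |s x| ≤ 1) (hsK : ∀ x ∉ K, s x = 0) :
    ∃ (L : Set (EuclideanSpace ℝ (Fin n))) (ψ : ℕ → EuclideanSpace ℝ (Fin n) → ℝ),
      IsCompact L ∧ L ⊆ U ∧ (∀ k, ContDiff ℝ 1 (ψ k)) ∧ (∀ k, tsupport (ψ k) ⊆ L) ∧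
      (∀ k x, |ψ k x| ≤ 1) ∧
      ∀ᵐ x ∂(volume : Measure (EuclideanSpace ℝ (Fin n))),
        Tendsto (fun k => ψ k x) atTop (𝓝 (s x)) := by
  obtain ⟨r, hr, hrU⟩ := hK.exists_cthickening_subset_open hU hKU
  -- Outer radii at most `r` keep the supports in the thickening. The fixed ratio 2 of outer to
  -- inner radius is what almost everywhere convergence of the convolutions requires.
  let φ : ℕ → ContDiffBump (0 : EuclideanSpace ℝ (Fin n)) := fun k =>
    ⟨r / (k + 1) / 2, r / (k + 1), by positivity, half_lt_self (by positivity)⟩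
  have hφr : ∀ k, (φ k).rOut ≤ r := fun k => by
    refine div_le_self hr.le ?_
    have : (0 : ℝ) ≤ k := k.cast_nonneg
    linarith
  have hsi : Integrable s volume := by
    have : IntegrableOn s K volume := by
      refine Measure.integrableOn_of_bounded (M := 1) hK.measure_ne_top hs ?_
      exact ae_of_all _ fun x => hs1 x
    refine (integrableOn_iff_integrable_of_support_subset fun x hx => ?_).1 this
    by_contra h
    exact hx (hsK x h)
  let ψ : ℕ → EuclideanSpace ℝ (Fin n) → ℝ := fun k =>
    (φ k).normed volume ⋆[ContinuousLinearMap.lsmul ℝ ℝ, volume] s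
  have hsupp : ∀ k, tsupport (ψ k) ⊆ Metric.cthickening r K := by
    intro k
    refine closure_minimal ?_ Metric.isClosed_cthickening
    refine (support_convolution_subset _).trans ?_
    rintro _ ⟨a, ha, b, hb, rfl⟩
    rw [ContDiffBump.support_normed_eq, mem_ball_zero_iff] at ha
    have hbK : b ∈ K := by
      by_contra h
      exact hb (hsK b h)
    refine Metric.mem_cthickening_of_dist_le _ b r K hbK ?_
    rw [dist_eq_norm]
    simpa using ha.le.trans (hφr k)
  refine ⟨Metric.cthickening r K, ψ, hK.cthickening, hrU, fun k => ?_, hsupp, fun k x => ?_, ?_⟩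
  · exact (φ k).hasCompactSupport_normed.contDiff_convolution_left _ (φ k).contDiff_normed
      hsi.locallyIntegrable
  · rw [← (φ k).integral_normed (μ := volume), ← Real.norm_eq_abs]
    refine norm_integral_le_of_norm_le (φ k).integrable_normed (ae_of_all _ fun t => ?_)
    simp only [ContinuousLinearMap.lsmul_apply, smul_eq_mul, norm_mul, Real.norm_eq_abs]
    rw [abs_of_nonneg ((φ k).nonneg_normed t)]
    exact mul_le_of_le_one_right ((φ k).nonneg_normed t) (hs1 _)
  · refine ContDiffBump.ae_convolution_tendsto_right_of_locallyIntegrable (K := 2) ?_ ?_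
      hsi.locallyIntegrable
    · have := (tendsto_one_div_add_atTop_nhds_zero_nat (𝕜 := ℝ)).const_mul r
      simpa [φ, div_eq_mul_inv] using this
    · refine Eventually.of_forall fun k => ?_
      simp only [φ]
      linarith

/-- An `L¹`-bound by duality with smooth compactly supported functions. -/
theorem lintegral_enorm_le_of_duality {U : Set (EuclideanSpace ℝ (Fin n))} (hU : IsOpen U)
    {u : EuclideanSpace ℝ (Fin n) → ℝ} (hu : LocallyIntegrableOn u U volume) {M : ℝ}
    (h : ∀ ψ : EuclideanSpace ℝ (Fin n) → ℝ, ContDiff ℝ 1 ψ → HasCompactSupport ψ →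
      tsupport ψ ⊆ U → (∀ x, |ψ x| ≤ 1) → ∫ x, u x * ψ x ≤ M) :
    ∫⁻ x in U, ‖u x‖ₑ ≤ ENNReal.ofReal M := by
  obtain ⟨F, hFc, hFU, hFe, hFm⟩ := exists_isCompact_exhaustion hU
  rw [← hFe, setLIntegral_iUnion_of_directed _ hFm.directed_le]
  refine iSup_le fun k => ?_
  have hiK : IntegrableOn u (F k) volume := hu.integrableOn_compact_subset (hFU k) (hFc k)
  let v := hiK.aestronglyMeasurable.mk u
  have hv : Measurable v := hiK.aestronglyMeasurable.stronglyMeasurable_mk.measurable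
  have huv : ∀ᵐ x ∂volume.restrict (F k), u x = v x := hiK.aestronglyMeasurable.ae_eq_mk
  -- The sign of `u` cut off to `F k`, so that `u * s = |u|` there; the representative `v` makes it
  -- measurable.
  let s : EuclideanSpace ℝ (Fin n) → ℝ := (F k).indicator fun x => if 0 ≤ v x then 1 else -1
  have hs : Measurable s := (Measurable.ite (measurableSet_le measurable_const hv)
    measurable_const measurable_const).indicator (hFc k).measurableSet
  obtain ⟨L, ψ, hL, hLU, hψ, hψL, hψ1, hlim⟩ := exists_smooth_approx hU (hFc k) (hFU k)
    hs.aestronglyMeasurable (s := s) (fun x => by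
      by_cases hx : x ∈ F k
      · simp only [s, indicator_of_mem hx]
        split_ifs <;> simp
      · simp [s, hx]) (fun x hx => by simp [s, hx])
  have hiL : IntegrableOn u L volume := hu.integrableOn_compact_subset hLU hL
  have hint : ∀ᵐ x ∂(volume : Measure (EuclideanSpace ℝ (Fin n))),
      u x * s x = (F k).indicator (fun x => ‖u x‖) x := by
    filter_upwards [(ae_restrict_iff' (hFc k).measurableSet).1 huv] with x hx
    by_cases hxF : x ∈ F k
    · simp only [s, indicator_of_mem hxF, hx hxF, Real.norm_eq_abs]
      split_ifs with h0
      · rw [abs_of_nonneg h0, mul_one]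
      · rw [abs_of_neg (not_le.1 h0), mul_neg_one]
    · simp [s, hxF]
  have hle : ∫ x, u x * s x ≤ M := by
    have ht : Tendsto (fun m => ∫ x, u x * ψ m x) atTop (𝓝 (∫ x, u x * s x)) := by
      refine tendsto_integral_of_dominated_convergence (L.indicator fun x => ‖u x‖)
        (fun m => ?_)
        (IntegrableOn.integrable_indicator (f := fun x => ‖u x‖) hiL.norm hL.measurableSet)
        (fun m => ?_) ?_
      · exact (integrable_mul_of_tsupport_subset hu (hψ m).continuous
          (HasCompactSupport.of_support_subset_isCompact hL
            ((subset_tsupport _).trans (hψL m))) ((hψL m).trans hLU)).aestronglyMeasurable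
      · refine ae_of_all _ fun x => ?_
        by_cases hx : x ∈ L
        · rw [indicator_of_mem hx, norm_mul]
          exact mul_le_of_le_one_right (norm_nonneg _) (hψ1 m x)
        · rw [indicator_of_notMem hx, image_eq_zero_of_notMem_tsupport fun h => hx (hψL m h)]
          simp
      · filter_upwards [hlim] with x hx
        exact hx.const_mul _
    refine le_of_tendsto' ht fun m => h _ (hψ m) ?_ ((hψL m).trans hLU) (hψ1 m)
    exact HasCompactSupport.of_support_subset_isCompact hL ((subset_tsupport _).trans (hψL m))
  rw [integral_congr_ae hint, integral_indicator (hFc k).measurableSet] at hle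
  rw [← ofReal_integral_norm_eq_lintegral_enorm hiK]
  exact ENNReal.ofReal_le_ofReal hle

/-! ### Translates controlled by the variation -/

theorem divergence_smul_const {I : EuclideanSpace ℝ (Fin n) → ℝ}
    {x : EuclideanSpace ℝ (Fin n)} (hI : DifferentiableAt ℝ I x)
    (v : EuclideanSpace ℝ (Fin n)) :
    divergence (fun y => I y • v) x = fderiv ℝ I x v := by
  have hv : v = ∑ i, v i • EuclideanSpace.single i (1 : ℝ) := by
    ext j
    simp [Finset.sum_apply, Pi.single_apply]
  rw [divergence, fderiv_smul_const hI]
  conv_rhs => rw [hv, map_sum]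
  refine Finset.sum_congr rfl fun i _ => ?_
  simp [mul_comm]

theorem hasFDerivAt_integral_translate {ψ : EuclideanSpace ℝ (Fin n) → ℝ}
    (hψ : ContDiff ℝ 1 ψ) (hc : HasCompactSupport ψ) (h x : EuclideanSpace ℝ (Fin n)) :
    HasFDerivAt (fun x => ∫ t in (0 : ℝ)..1, ψ (x - t • h))
      (∫ t in (0 : ℝ)..1, fderiv ℝ ψ (x - t • h)) x := by
  have hψ' : Continuous (fderiv ℝ ψ) := hψ.continuous_fderiv one_ne_zero
  have hψc : Continuous ψ := hψ.continuous
  obtain ⟨C, hC⟩ := (hc.fderiv (𝕜 := ℝ)).exists_bound_of_continuous hψ'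
  refine intervalIntegral.hasFDerivAt_integral_of_dominated_of_fderiv_le
    (F := fun x t => ψ (x - t • h)) (F' := fun x t => fderiv ℝ ψ (x - t • h))
    (bound := fun _ => C) (s := univ) univ_mem ?_ ?_ ?_ ?_ ?_ ?_
  · exact Eventually.of_forall fun y =>
      (by fun_prop : Continuous fun t : ℝ => ψ (y - t • h)).aestronglyMeasurable
  · exact (by fun_prop : Continuous fun t : ℝ => ψ (x - t • h)).intervalIntegrable _ _
  · exact (by fun_prop : Continuous fun t : ℝ => fderiv ℝ ψ (x - t • h)).aestronglyMeasurable
  · exact ae_of_all _ fun t _ y _ => hC _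
  · exact intervalIntegrable_const
  · refine ae_of_all _ fun t _ y _ => ?_
    have h1 : HasFDerivAt ψ (fderiv ℝ ψ (y - t • h)) (y - t • h) :=
      (hψ.differentiable one_ne_zero _).hasFDerivAt
    exact h1.comp y ((hasFDerivAt_id y).sub_const (t • h))

theorem contDiff_integral_translate {ψ : EuclideanSpace ℝ (Fin n) → ℝ}
    (hψ : ContDiff ℝ 1 ψ) (hc : HasCompactSupport ψ) (h : EuclideanSpace ℝ (Fin n)) :
    ContDiff ℝ 1 fun x => ∫ t in (0 : ℝ)..1, ψ (x - t • h) := by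
  refine contDiff_one_iff_hasFDerivAt.2
    ⟨_, ?_, fun x => hasFDerivAt_integral_translate hψ hc h x⟩
  have hψ' : Continuous (fderiv ℝ ψ) := hψ.continuous_fderiv one_ne_zero
  exact intervalIntegral.continuous_parametric_intervalIntegral_of_continuous'
    (by fun_prop) _ _

/-- The fundamental theorem of calculus along the segment from `x` to `x - h`. It exhibits a finite
difference of `ψ` as a directional derivative of an average, hence as the divergence of a field. -/
theorem fderiv_integral_translate {ψ : EuclideanSpace ℝ (Fin n) → ℝ}
    (hψ : ContDiff ℝ 1 ψ) (hc : HasCompactSupport ψ) (h x : EuclideanSpace ℝ (Fin n)) :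
    fderiv ℝ (fun x => ∫ t in (0 : ℝ)..1, ψ (x - t • h)) x h = ψ x - ψ (x - h) := by
  have hψ' : Continuous (fderiv ℝ ψ) := hψ.continuous_fderiv one_ne_zero
  rw [(hasFDerivAt_integral_translate hψ hc h x).fderiv,
    ContinuousLinearMap.intervalIntegral_apply
      ((by fun_prop : Continuous fun t : ℝ => fderiv ℝ ψ (x - t • h)).intervalIntegrable _ _)]
  have hd : ∀ t ∈ uIcc (0 : ℝ) 1,
      HasDerivAt (fun t : ℝ => -ψ (x - t • h)) (fderiv ℝ ψ (x - t • h) h) t := by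
    intro t _
    have h1 : HasFDerivAt ψ (fderiv ℝ ψ (x - t • h)) (x - t • h) :=
      (hψ.differentiable one_ne_zero _).hasFDerivAt
    have h2 : HasDerivAt (fun t : ℝ => x - t • h) (-h) t := by
      simpa using ((hasDerivAt_id t).smul_const h).const_sub x
    have h3 : HasDerivAt (fun t : ℝ => ψ (x - t • h)) (fderiv ℝ ψ (x - t • h) (-h)) t :=
      h1.comp_hasDerivAt t h2
    simpa using h3.fun_neg
  rw [intervalIntegral.integral_eq_sub_of_hasDerivAt hd
    ((by fun_prop : Continuous fun t : ℝ => fderiv ℝ ψ (x - t • h) h).intervalIntegrable _ _)]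
  simp only [one_smul, zero_smul, sub_zero]
  ring

/-- The difference of a function and its translate, tested against a smooth function, is
controlled by the variation in a convex set. -/
theorem integral_translate_sub_mul_le {f : EuclideanSpace ℝ (Fin n) → ℝ}
    {U : Set (EuclideanSpace ℝ (Fin n))} (hU : Convex ℝ U)
    (hf : LocallyIntegrableOn f U volume) (hv : variation f U ≠ ∞)
    (h : EuclideanSpace ℝ (Fin n)) {ψ : EuclideanSpace ℝ (Fin n) → ℝ} (hψ : ContDiff ℝ 1 ψ)
    (hc : HasCompactSupport ψ) (hψU : tsupport ψ ⊆ {x | x ∈ U ∧ x + h ∈ U})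
    (hψ1 : ∀ x, |ψ x| ≤ 1) :
    ∫ x, (f (x + h) - f x) * ψ x ≤ ‖h‖ * (variation f U).toReal := by
  rcases eq_or_ne h 0 with rfl | h0
  · simp
  have hn : 0 < ‖h‖ := norm_pos_iff.2 h0
  set I : EuclideanSpace ℝ (Fin n) → ℝ := fun x => ∫ t in (0 : ℝ)..1, ψ (x - t • h) with hI
  have hIc : ContDiff ℝ 1 I := contDiff_integral_translate hψ hc h
  -- The support of `ψ` swept along `h`; it contains the support of `I`, and convexity keeps it in
  -- `U`.
  set S : Set (EuclideanSpace ℝ (Fin n)) :=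
    (fun p : ℝ × EuclideanSpace ℝ (Fin n) => p.2 + p.1 • h) '' (Icc 0 1 ×ˢ tsupport ψ) with hS
  have hSc : IsCompact S := (isCompact_Icc.prod hc.isCompact).image (by fun_prop)
  have hSU : S ⊆ U := by
    rintro _ ⟨⟨t, y⟩, ⟨ht, hy⟩, rfl⟩
    exact hU.add_smul_mem (hψU hy).1 (hψU hy).2 ht
  have hI0 : ∀ x ∉ S, I x = 0 := by
    intro x hx
    have : ∀ t ∈ uIcc (0 : ℝ) 1, ψ (x - t • h) = 0 := fun t ht => by
      refine image_eq_zero_of_notMem_tsupport fun hxt => hx ⟨(t, x - t • h), ⟨?_, hxt⟩, by simp⟩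
      simpa using ht
    rw [hI]
    simp only
    rw [intervalIntegral.integral_congr this]
    simp
  have hI1 : ∀ x, |I x| ≤ 1 := fun x => by
    have := intervalIntegral.norm_integral_le_of_norm_le_const (a := 0) (b := 1) (C := 1)
      (f := fun t : ℝ => ψ (x - t • h)) fun t _ => hψ1 _
    simpa using this
  -- With this unit vector the divergence of `I • v` is `(ψ(x - h) - ψ(x)) / ‖h‖`; a change of
  -- variables moves the difference onto `f`.
  set v : EuclideanSpace ℝ (Fin n) := -(‖h‖⁻¹ • h) with hvdef
  have hvn : ‖v‖ = 1 := by
    rw [hvdef, norm_neg, norm_smul, norm_inv, norm_norm, inv_mul_cancel₀ hn.ne']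
  have hsupp : tsupport (fun x => I x • v) ⊆ S := by
    refine closure_minimal (fun x hx => ?_) hSc.isClosed
    by_contra hxS
    exact hx (by simp [hI0 x hxS])
  have htest : IsTestField U fun x => I x • v :=
    ⟨hIc.smul contDiff_const, HasCompactSupport.of_support_subset_isCompact hSc
      ((subset_tsupport _).trans hsupp), hsupp.trans hSU, fun x => by
        rw [norm_smul, hvn, mul_one]; exact hI1 x⟩
  have hdiv : ∀ x, divergence (fun x => I x • v) x = ‖h‖⁻¹ * (ψ (x - h) - ψ x) := fun x => by
    rw [divergence_smul_const (hIc.differentiable one_ne_zero x), hvdef, map_neg, map_smul,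
      fderiv_integral_translate hψ hc h x, smul_eq_mul]
    ring
  have hcomp : Continuous fun x => ψ (x - h) :=
    hψ.continuous.comp (continuous_id.sub continuous_const)
  have hsub : tsupport (fun x => ψ (x - h)) ⊆ (fun x => x + h) '' tsupport ψ := by
    refine closure_minimal (fun x hx => ⟨x - h, subset_tsupport _ hx, by simp⟩) ?_
    exact (hc.isCompact.image (by fun_prop)).isClosed
  have hcs : HasCompactSupport fun x => ψ (x - h) :=
    HasCompactSupport.of_support_subset_isCompact (hc.isCompact.image (f := fun x => x + h)
      (by fun_prop)) ((subset_tsupport _).trans hsub)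
  have hi1 : Integrable fun x => f x * ψ (x - h) :=
    integrable_mul_of_tsupport_subset hf hcomp hcs (hsub.trans (by
      rintro _ ⟨y, hy, rfl⟩
      exact (hψU hy).2))
  have hi2 : Integrable fun x => f x * ψ x :=
    integrable_mul_of_tsupport_subset hf hψ.continuous hc fun x hx => (hψU hx).1
  have hi3 : Integrable fun x => f (x + h) * ψ x := by
    simpa using hi1.comp_add_right h
  have heq : ∫ x, (f (x + h) - f x) * ψ x =
      ‖h‖ * ∫ x in U, f x * divergence (fun x => I x • v) x := by
    rw [setIntegral_test f htest.tsupport_subset]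
    simp only [hdiv]
    calc ∫ x, (f (x + h) - f x) * ψ x = (∫ x, f (x + h) * ψ x) - ∫ x, f x * ψ x := by
          rw [← integral_sub hi3 hi2]
          simp only [sub_mul]
      _ = (∫ x, f x * ψ (x - h)) - ∫ x, f x * ψ x := by
          congr 1
          rw [← integral_add_right_eq_self (fun x => f x * ψ (x - h)) h]
          simp
      _ = ∫ x, (f x * ψ (x - h) - f x * ψ x) := (integral_sub hi1 hi2).symm
      _ = ‖h‖ * ∫ x, f x * (‖h‖⁻¹ * (ψ (x - h) - ψ x)) := by
          rw [← integral_const_mul]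
          congr 1
          ext x
          field_simp
  rw [heq]
  refine mul_le_mul_of_nonneg_left ?_ hn.le
  have hle : ENNReal.ofReal (∫ x in U, f x * divergence (fun x => I x • v) x) ≤ variation f U :=
    le_iSup₂_of_le (fun x => I x • v) htest le_rfl
  exact (ENNReal.ofReal_le_iff_le_toReal hv).1 hle

theorem lintegral_translate_sub_le {f : EuclideanSpace ℝ (Fin n) → ℝ}
    {U : Set (EuclideanSpace ℝ (Fin n))} (hUo : IsOpen U) (hU : Convex ℝ U)
    (hf : LocallyIntegrableOn f U volume) (hv : variation f U ≠ ∞)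
    (h : EuclideanSpace ℝ (Fin n)) :
    ∫⁻ x in {x | x ∈ U ∧ x + h ∈ U}, ‖f (x + h) - f x‖ₑ ≤ ENNReal.ofReal ‖h‖ * variation f U := by
  have ho : IsOpen {x | x ∈ U ∧ x + h ∈ U} :=
    hUo.inter (hUo.preimage (continuous_id.add continuous_const))
  have hu : LocallyIntegrableOn (fun x => f (x + h) - f x) {x | x ∈ U ∧ x + h ∈ U} volume := by
    rw [locallyIntegrableOn_iff ho.isLocallyClosed]
    intro K hK hKc
    refine Integrable.sub ?_ (hf.integrableOn_compact_subset (hK.trans fun x hx => hx.1) hKc)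
    have hi : IntegrableOn f ((fun x => x + h) '' K) volume :=
      hf.integrableOn_compact_subset (by rintro _ ⟨y, hy, rfl⟩; exact (hK hy).2)
        (hKc.image (by fun_prop))
    rw [← (measurePreserving_add_right volume h).integrableOn_comp_preimage
      (measurableEmbedding_addRight h), preimage_image_eq _ (add_left_injective h)] at hi
    exact hi
  refine (lintegral_enorm_le_of_duality ho hu fun ψ h1 h2 h3 h4 =>
    integral_translate_sub_mul_le hU hf hv h h1 h2 h3 h4).trans ?_
  rw [ENNReal.ofReal_mul (norm_nonneg h), ENNReal.ofReal_toReal hv]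

/-! ### The Poincaré inequality and the upper bound of `G` -/

theorem variation_congr_ae {f g : EuclideanSpace ℝ (Fin n) → ℝ}
    {U : Set (EuclideanSpace ℝ (Fin n))} (h : f =ᵐ[volume.restrict U] g) :
    variation f U = variation g U := by
  refine iSup_congr fun φ => iSup_congr fun _ => ?_
  congr 1
  exact integral_congr_ae (h.mono fun x hx => by simp only [hx])

theorem osc_congr_ae {f g : EuclideanSpace ℝ (Fin n) → ℝ}
    {U : Set (EuclideanSpace ℝ (Fin n))} (h : f =ᵐ[volume.restrict U] g) :
    osc f U = osc g U := by
  rw [osc, osc, average_congr h]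
  exact laverage_congr (h.mono fun x hx => by simp only [hx])

/-- The deviation from the mean is the mean of the differences. If `g` is not integrable, the inner
integral on the right is infinite for every `x`, so the default value `0` of the mean is harmless.
-/
theorem lintegral_enorm_sub_integral_le {α : Type*} [MeasurableSpace α] (ν : Measure α)
    [IsProbabilityMeasure ν] {g : α → ℝ} (hg : Measurable g) :
    ∫⁻ x, ‖g x - ∫ y, g y ∂ν‖ₑ ∂ν ≤ ∫⁻ x, ∫⁻ y, ‖g x - g y‖ₑ ∂ν ∂ν := by
  refine lintegral_mono fun x => ?_
  by_cases hi : Integrable g ν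
  · have : g x - ∫ y, g y ∂ν = ∫ y, (g x - g y) ∂ν := by
      rw [integral_sub (integrable_const _) hi]
      simp
    rw [this]
    exact enorm_integral_le_lintegral_enorm _
  · refine le_top.trans (top_le_iff.2 ?_).ge
    by_contra hne
    refine hi ?_
    have h1 : Integrable (fun y => g x - g y) ν :=
      ⟨(measurable_const.sub hg).aestronglyMeasurable, lt_top_iff_ne_top.2 hne⟩
    refine ((integrable_const (g x)).sub h1).congr (ae_of_all _ fun y => ?_)
    simp

/-- Substitute `y = x + h`, exchange the integrals, and apply the translation estimate for each
fixed `h`. -/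
theorem lintegral_lintegral_sub_le {g : EuclideanSpace ℝ (Fin n) → ℝ} (hg : Measurable g)
    (Q : Cube n) (hgi : LocallyIntegrableOn g Q.carrier volume)
    (hv : variation g Q.carrier ≠ ∞) :
    ∫⁻ x in Q.carrier, ∫⁻ y in Q.carrier, ‖g x - g y‖ₑ ≤
      ENNReal.ofReal (2 * Q.side) ^ n * (ENNReal.ofReal (n * Q.side) * variation g Q.carrier) := by
  let Φ : EuclideanSpace ℝ (Fin n) × EuclideanSpace ℝ (Fin n) → ℝ≥0∞ :=
    (Q.carrier ×ˢ Q.carrier).indicator fun p => ‖g p.1 - g p.2‖ₑ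
  have hQm : MeasurableSet Q.carrier := Q.isOpen.measurableSet
  have hΦ : Measurable Φ := by
    refine Measurable.indicator ?_ (hQm.prod hQm)
    exact ((hg.comp measurable_fst).sub (hg.comp measurable_snd)).enorm
  -- Contains all differences of points of `Q`, so only these `h` contribute.
  let D : Cube n := ⟨0, 2 * Q.side, by linarith [Q.side_pos], Q.frame⟩
  have h1 : ∀ x, Q.carrier.indicator (fun x => ∫⁻ y in Q.carrier, ‖g x - g y‖ₑ) x =
      ∫⁻ h, Φ (x, x + h) := by
    intro x
    rw [lintegral_add_left_eq_self (fun y => Φ (x, y)) x]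
    by_cases hx : x ∈ Q.carrier
    · rw [indicator_of_mem hx, ← lintegral_indicator hQm]
      refine lintegral_congr fun y => ?_
      by_cases hy : y ∈ Q.carrier <;> simp [Φ, hx, hy]
    · simp [Φ, hx]
  have h2 : ∀ h, ∫⁻ x, Φ (x, x + h) ≤ D.carrier.indicator
      (fun _ => ENNReal.ofReal (n * Q.side) * variation g Q.carrier) h := by
    intro h
    have hm : MeasurableSet {x | x ∈ Q.carrier ∧ x + h ∈ Q.carrier} :=
      hQm.inter (measurable_add_const h hQm)
    have heq : ∫⁻ x, Φ (x, x + h) =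
        ∫⁻ x in {x | x ∈ Q.carrier ∧ x + h ∈ Q.carrier}, ‖g (x + h) - g x‖ₑ := by
      rw [← lintegral_indicator hm]
      refine lintegral_congr fun x => ?_
      by_cases hx : x ∈ Q.carrier ∧ x + h ∈ Q.carrier
      · rw [indicator_of_mem (show x ∈ {x | x ∈ Q.carrier ∧ x + h ∈ Q.carrier} from hx)]
        simp [Φ, hx, enorm_sub_rev]
      · rw [indicator_of_notMem (show x ∉ {x | x ∈ Q.carrier ∧ x + h ∈ Q.carrier} from hx)]
        simp only [Φ, indicator_apply_eq_zero, mem_prod]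
        exact fun h => absurd h hx
    by_cases hne : ∃ x, x ∈ Q.carrier ∧ x + h ∈ Q.carrier
    · obtain ⟨x, hx, hxh⟩ := hne
      have hD : h ∈ D.carrier := by
        intro i
        have e : Q.frame (h - 0) = Q.frame (x + h - Q.center) - Q.frame (x - Q.center) := by
          rw [← map_sub]; congr 1; abel
        have e1 := abs_lt.1 (hx i)
        have e2 := abs_lt.1 (hxh i)
        change |(Q.frame (h - 0)) i| < 2 * Q.side / 2
        rw [e, PiLp.sub_apply, abs_lt]
        constructor <;> linarith [e1.1, e1.2, e2.1, e2.2]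
      have hn : ‖h‖ ≤ n * Q.side := by
        have := Q.dist_le hxh hx
        rwa [dist_eq_norm, add_sub_cancel_left] at this
      rw [indicator_of_mem hD, heq]
      refine (lintegral_translate_sub_le Q.isOpen Q.convex hgi hv h).trans ?_
      gcongr
    · rw [heq, (eq_empty_of_forall_notMem fun x hx => hne ⟨x, hx⟩ :
        {x | x ∈ Q.carrier ∧ x + h ∈ Q.carrier} = ∅)]
      simp
  calc ∫⁻ x in Q.carrier, ∫⁻ y in Q.carrier, ‖g x - g y‖ₑ = ∫⁻ x, ∫⁻ h, Φ (x, x + h) := by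
        rw [← lintegral_indicator hQm]
        exact lintegral_congr h1
    _ = ∫⁻ h, ∫⁻ x, Φ (x, x + h) := by
        refine lintegral_lintegral_swap (Measurable.aemeasurable ?_)
        exact hΦ.comp (measurable_fst.prodMk (measurable_fst.add measurable_snd))
    _ ≤ ∫⁻ h, D.carrier.indicator
          (fun _ => ENNReal.ofReal (n * Q.side) * variation g Q.carrier) h := lintegral_mono h2
    _ = _ := by
        rw [lintegral_indicator_const D.isOpen.measurableSet, D.volume_carrier, mul_comm]

/-- The Poincaré inequality on cubes. -/
theorem side_pow_mul_osc_le (hn : 1 ≤ n) {f : EuclideanSpace ℝ (Fin n) → ℝ} (Q : Cube n)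
    (hf : LocallyIntegrableOn f Q.carrier volume) :
    ENNReal.ofReal Q.side ^ (n - 1) * osc f Q.carrier ≤ 2 ^ n * n * variation f Q.carrier := by
  by_cases hv : variation f Q.carrier = ∞
  · rw [hv, ENNReal.mul_top]
    · exact le_top
    · have : (n : ℝ≥0∞) ≠ 0 := by simpa using (by omega : n ≠ 0)
      positivity
  have hm : AEStronglyMeasurable f (volume.restrict Q.carrier) := hf.aestronglyMeasurable
  set g := hm.mk f with hgdef
  have hg : Measurable g := hm.stronglyMeasurable_mk.measurable
  -- Variation and oscillation see only the almost everywhere class, while Tonelli needs a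
  -- measurable function.
  have hfg : f =ᵐ[volume.restrict Q.carrier] g := hm.ae_eq_mk
  rw [variation_congr_ae hfg] at hv ⊢
  rw [osc_congr_ae hfg]
  have hgi : LocallyIntegrableOn g Q.carrier volume := by
    rw [locallyIntegrableOn_iff Q.isOpen.isLocallyClosed] at hf ⊢
    intro K hK hKc
    exact (hf K hK hKc).congr (ae_restrict_of_ae_restrict_of_subset hK hfg)
  set L := ENNReal.ofReal Q.side with hL
  have hL0 : L ≠ 0 := by simpa [hL] using Q.side_pos
  have hLt : L ≠ ∞ := ENNReal.ofReal_ne_top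
  have hvol := Q.volume_carrier
  set ν : Measure (EuclideanSpace ℝ (Fin n)) :=
    (volume Q.carrier)⁻¹ • volume.restrict Q.carrier with hν
  have : IsProbabilityMeasure ν := ⟨by
    rw [hν, Measure.smul_apply, Measure.restrict_apply_univ, smul_eq_mul,
      ENNReal.inv_mul_cancel Q.volume_ne_zero Q.volume_ne_top]⟩
  -- One factor `(L ^ n)⁻¹` for each of the two averages; with `L ^ (n - 1)` in front, all powers of
  -- `L` cancel.
  have hosc : osc g Q.carrier ≤ (L ^ n)⁻¹ * ((L ^ n)⁻¹ * (ENNReal.ofReal (2 * Q.side) ^ n *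
      (ENNReal.ofReal (n * Q.side) * variation g Q.carrier))) := by
    rw [osc, setLAverage_eq', setAverage_eq']
    refine (lintegral_enorm_sub_integral_le ν hg).trans ?_
    rw [hν, lintegral_smul_measure, smul_eq_mul, hvol]
    gcongr
    simp only [lintegral_smul_measure, smul_eq_mul]
    rw [lintegral_const_mul' _ _ (ENNReal.inv_ne_top.2 (pow_ne_zero n hL0))]
    gcongr
    exact lintegral_lintegral_sub_le hg Q hgi hv
  refine (mul_le_mul_right hosc _).trans (le_of_eq ?_)
  rw [ENNReal.ofReal_mul zero_le_two, ENNReal.ofReal_mul n.cast_nonneg, ← hL, ENNReal.ofReal_natCast,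
    ENNReal.ofReal_ofNat, mul_pow]
  have hLn : L ^ (n - 1) * L = L ^ n := by
    rw [← pow_succ, Nat.sub_add_cancel hn]
  have hc : (L ^ n)⁻¹ * L ^ n = 1 :=
    ENNReal.inv_mul_cancel (pow_ne_zero n hL0) (ENNReal.pow_ne_top hLt)
  calc _ = ((L ^ n)⁻¹ * L ^ n) * ((L ^ n)⁻¹ * (L ^ (n - 1) * L)) *
        (2 ^ n * n * variation g Q.carrier) := by ring
    _ = _ := by rw [hLn, hc, one_mul, one_mul]

theorem tsum_variation_le {ι : Type*} (f : EuclideanSpace ℝ (Fin n) → ℝ)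
    {U : Set (EuclideanSpace ℝ (Fin n))} (V : ι → Set (EuclideanSpace ℝ (Fin n)))
    (hd : Pairwise fun i j => Disjoint (V i) (V j)) (hV : ∀ i, V i ⊆ U) :
    ∑' i, variation f (V i) ≤ variation f U := by
  have key : ∀ t : Finset ι, ∑ i ∈ t, variation f (V i) ≤ variation f (⋃ i ∈ t, V i) := by
    intro t
    classical
    induction t using Finset.induction_on with
    | empty => simp
    | insert a t ha ih =>
      rw [Finset.sum_insert ha, Finset.set_biUnion_insert]
      refine (add_le_add le_rfl ih).trans
        (variation_superadd f ?_ subset_union_left subset_union_right)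
      rw [disjoint_iUnion₂_right]
      exact fun i hi => hd fun h => ha (h ▸ hi)
  have hmono : ∀ W ⊆ U, variation f W ≤ variation f U := fun W hW => by
    simpa [variation_empty] using variation_superadd f (disjoint_empty W) hW (empty_subset U)
  rw [ENNReal.tsum_eq_iSup_sum]
  exact iSup_le fun t => (key t).trans (hmono _ (iUnion₂_subset fun i _ => hV i))

theorem Geps_le_variation (hn : 1 ≤ n) (ε : ℝ) {f : EuclideanSpace ℝ (Fin n) → ℝ}
    {U : Set (EuclideanSpace ℝ (Fin n))} (hf : LocallyIntegrableOn f U volume) :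
    Geps ε f U ≤ 2 ^ n * n * variation f U := by
  refine iSup₂_le fun H hH => ?_
  calc _ ≤ ∑' Q : H, 2 ^ n * n * variation f (Q : Cube n).carrier :=
        ENNReal.tsum_le_tsum fun Q =>
          side_pow_mul_osc_le hn _ (hf.mono_set (hH.subset _ Q.2))
    _ = 2 ^ n * n * ∑' Q : H, variation f (Q : Cube n).carrier := ENNReal.tsum_mul_left
    _ ≤ _ := by
        gcongr
        exact tsum_variation_le f (fun Q : H => (Q : Cube n).carrier)
          (fun Q R hne => hH.disjoint Q.2 R.2 fun h => hne (Subtype.ext h))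
          fun Q => hH.subset _ Q.2

theorem G_le_variation (hn : 1 ≤ n) {f : EuclideanSpace ℝ (Fin n) → ℝ}
    {U : Set (EuclideanSpace ℝ (Fin n))} (hf : LocallyIntegrableOn f U volume) :
    G f U ≤ 2 ^ n * n * variation f U :=
  iInf₂_le_of_le 1 one_pos (Geps_le_variation hn 1 hf)

/-! ### Grids and the lower bound of `G` -/

/-- The cell with index `z` of the half-open grid of mesh `h`. -/
def gridCell (h : ℝ) (z : Fin n → ℤ) : Set (EuclideanSpace ℝ (Fin n)) :=
  {x | ∀ i, ⌊x i / h⌋ = z i}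

/-- The open cube of sidelength `4 * h` concentric with `gridCell h z`. -/
noncomputable def gridCube {h : ℝ} (hh : 0 < h) (z : Fin n → ℤ) : Cube n where
  center := WithLp.toLp 2 fun i => h * (z i + 1 / 2)
  side := 4 * h
  side_pos := by linarith
  frame := LinearIsometryEquiv.refl ℝ _

theorem mem_gridCube {h : ℝ} (hh : 0 < h) {z : Fin n → ℤ} {x : EuclideanSpace ℝ (Fin n)} :
    x ∈ (gridCube hh z).carrier ↔ ∀ i, |x i - h * (z i + 1 / 2)| < 2 * h := by
  have : 4 * h / 2 = 2 * h := by ring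
  simp [Cube.carrier, gridCube, this]

theorem measurableSet_gridCell (h : ℝ) (z : Fin n → ℤ) : MeasurableSet (gridCell h z) := by
  have : gridCell h z = ⋂ i, {x | ⌊x i / h⌋ = z i} := by
    ext x
    simp [gridCell]
  rw [this]
  refine MeasurableSet.iInter fun i => ?_
  have hm : Measurable fun x : EuclideanSpace ℝ (Fin n) => ⌊x i / h⌋ :=
    Int.measurable_floor.comp (by fun_prop)
  exact hm (measurableSet_singleton (z i))

theorem mem_gridCell_bounds {h : ℝ} (hh : 0 < h) {z : Fin n → ℤ}
    {x : EuclideanSpace ℝ (Fin n)} (hx : x ∈ gridCell h z) (i : Fin n) :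
    h * z i ≤ x i ∧ x i < h * (z i + 1) := by
  have h1 := Int.floor_eq_iff.1 (hx i)
  rw [le_div_iff₀ hh, div_lt_iff₀ hh] at h1
  constructor <;> linarith [h1.1, h1.2]

theorem gridCell_subset_gridCube {h : ℝ} (hh : 0 < h) (z : Fin n → ℤ) :
    gridCell h z ⊆ (gridCube hh z).carrier := by
  intro x hx
  rw [mem_gridCube]
  intro i
  have := mem_gridCell_bounds hh hx i
  rw [abs_lt]
  constructor <;> linarith [this.1, this.2]

/-- The reason for sidelength `4h`: the shifted cell reaches distance `3h/2` from the centre in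
direction `j`, and an open cube of sidelength `3h` would miss its boundary. -/
theorem sub_single_mem_gridCube {h : ℝ} (hh : 0 < h) {z : Fin n → ℤ}
    {x : EuclideanSpace ℝ (Fin n)} (hx : x ∈ gridCell h z) (j : Fin n) :
    x - h • EuclideanSpace.single j (1 : ℝ) ∈ (gridCube hh z).carrier := by
  rw [mem_gridCube]
  intro i
  have := mem_gridCell_bounds hh hx i
  simp only [PiLp.sub_apply, PiLp.smul_apply, PiLp.single_apply, smul_eq_mul]
  rw [abs_lt]
  split_ifs <;> constructor <;> linarith [this.1, this.2]

/-- Some coordinate of the indices differs by at least 4, so the centres are at least one sidelength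
apart in that direction. -/
theorem disjoint_gridCube {h : ℝ} (hh : 0 < h) {z w : Fin n → ℤ} (hne : z ≠ w)
    (hc : (fun i => (z i : ZMod 4)) = fun i => (w i : ZMod 4)) :
    Disjoint (gridCube hh z).carrier (gridCube hh w).carrier := by
  obtain ⟨i, hi⟩ := Function.ne_iff.1 hne
  have hd : (4 : ℤ) ∣ w i - z i := by
    have := (ZMod.intCast_eq_intCast_iff_dvd_sub (z i) (w i) 4).1 (congrFun hc i)
    exact_mod_cast this
  rw [Set.disjoint_left]
  intro x hx hx'
  have h1 := abs_lt.1 ((mem_gridCube hh).1 hx i)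
  have h2 := abs_lt.1 ((mem_gridCube hh).1 hx' i)
  have h3 : h * ((w i : ℝ) - z i) < h * 4 := by linarith [h1.1, h1.2, h2.1, h2.2]
  have h4 : h * ((z i : ℝ) - w i) < h * 4 := by linarith [h1.1, h1.2, h2.1, h2.2]
  have h5 := lt_of_mul_lt_mul_left h3 hh.le
  have h6 := lt_of_mul_lt_mul_left h4 hh.le
  have h7 : w i - z i < 4 := by exact_mod_cast h5
  have h8 : z i - w i < 4 := by exact_mod_cast h6
  omega

/-- Both `f` and its translate are compared with the mean over the enlarged cube `Q`. Each
comparison costs `|Q|` times the oscillation, and `2 |Q| = 8h (4h) ^ (n - 1)`. -/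
theorem lintegral_gridCell_le (hn : 1 ≤ n) {f : EuclideanSpace ℝ (Fin n) → ℝ} {h : ℝ}
    (hh : 0 < h) (j : Fin n) (z : Fin n → ℤ) {T : Set (EuclideanSpace ℝ (Fin n))}
    (hT : T ⊆ gridCell h z) (hTm : MeasurableSet T)
    (hf : AEStronglyMeasurable f (volume.restrict T)) :
    ∫⁻ x in T, ‖f (x - h • EuclideanSpace.single j (1 : ℝ)) - f x‖ₑ ≤
      8 * ENNReal.ofReal h * (ENNReal.ofReal (gridCube hh z).side ^ (n - 1) *
        osc f (gridCube hh z).carrier) := by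
  set Q := gridCube hh z with hQ
  set e : EuclideanSpace ℝ (Fin n) := h • EuclideanSpace.single j (1 : ℝ) with he
  set c : ℝ := ⨍ y in Q.carrier, f y with hc
  have hQm : MeasurableSet Q.carrier := Q.isOpen.measurableSet
  have h1 : ∫⁻ x in T, ‖f x - c‖ₑ ≤ ∫⁻ x in Q.carrier, ‖f x - c‖ₑ :=
    lintegral_mono_set (hT.trans (gridCell_subset_gridCube hh z))
  have h2 : ∫⁻ x in T, ‖f (x - e) - c‖ₑ ≤ ∫⁻ x in Q.carrier, ‖f x - c‖ₑ := by
    rw [← lintegral_indicator hQm, ← lintegral_indicator hTm,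
      ← lintegral_sub_right_eq_self (Q.carrier.indicator fun x => ‖f x - c‖ₑ) e]
    refine lintegral_mono fun x => ?_
    by_cases hx : x ∈ T
    · rw [indicator_of_mem hx, indicator_of_mem (sub_single_mem_gridCube hh (hT hx) j)]
    · simp [hx]
  have h3 : ∫⁻ x in Q.carrier, ‖f x - c‖ₑ = osc f Q.carrier * volume Q.carrier := by
    rw [osc, setLAverage_eq, ENNReal.div_mul_cancel Q.volume_ne_zero Q.volume_ne_top]
  have hside : Q.side = 4 * h := rfl
  calc ∫⁻ x in T, ‖f (x - e) - f x‖ₑ ≤ ∫⁻ x in T, (‖f (x - e) - c‖ₑ + ‖f x - c‖ₑ) := by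
        refine lintegral_mono fun x => ?_
        have : f (x - e) - f x = (f (x - e) - c) - (f x - c) := by ring
        rw [this]
        exact enorm_sub_le
    _ = (∫⁻ x in T, ‖f (x - e) - c‖ₑ) + ∫⁻ x in T, ‖f x - c‖ₑ :=
        lintegral_add_right' _ (hf.sub aestronglyMeasurable_const).enorm
    _ ≤ osc f Q.carrier * volume Q.carrier + osc f Q.carrier * volume Q.carrier := by
        rw [← h3]
        exact add_le_add h2 h1
    _ = 2 * (ENNReal.ofReal Q.side ^ n * osc f Q.carrier) := by
        rw [Q.volume_carrier]
        ring
    _ = 2 * (ENNReal.ofReal Q.side ^ (n - 1) * ENNReal.ofReal Q.side * osc f Q.carrier) := by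
        rw [← pow_succ, Nat.sub_add_cancel hn]
    _ = _ := by
        conv_lhs => rw [hside, ENNReal.ofReal_mul zero_le_four]
        rw [hside, ENNReal.ofReal_mul zero_le_four, ENNReal.ofReal_ofNat]
        ring

/-- Sum over the cells that meet `K`; their cubes stay in the thickening. Residues of the indices
modulo 4 sort the cubes into `4 ^ n` disjoint families. -/
theorem lintegral_sub_translate_le (hn : 1 ≤ n) {f : EuclideanSpace ℝ (Fin n) → ℝ}
    {K V : Set (EuclideanSpace ℝ (Fin n))} (hK : IsCompact K)
    (hf : LocallyIntegrableOn f V volume) {r : ℝ} (hr : Metric.cthickening r K ⊆ V) {h : ℝ}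
    (hh : 0 < h) (hhr : n * (4 * h) ≤ r) (j : Fin n) :
    ∫⁻ x in K, ‖f (x - h • EuclideanSpace.single j (1 : ℝ)) - f x‖ₑ ≤
      8 * ENNReal.ofReal h * (4 ^ n * Geps (4 * h) f V) := by
  let Z := {z : Fin n → ℤ // (K ∩ gridCell h z).Nonempty}
  have hKe : K = ⋃ z : Z, K ∩ gridCell h z.1 := by
    refine subset_antisymm (fun x hx => ?_) (iUnion_subset fun z => inter_subset_left)
    have hxz : x ∈ K ∩ gridCell h fun i => ⌊x i / h⌋ := ⟨hx, fun i => rfl⟩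
    exact mem_iUnion.2 ⟨⟨_, x, hxz⟩, hxz⟩
  have hKV : K ⊆ V := (Metric.self_subset_cthickening K).trans hr
  have hfK : AEStronglyMeasurable f (volume.restrict K) :=
    (hf.integrableOn_compact_subset hKV hK).aestronglyMeasurable
  have hZV : ∀ z : Z, (gridCube hh z.1).carrier ⊆ V := by
    rintro ⟨z, x, hxK, hxz⟩ y hy
    refine hr (Metric.mem_cthickening_of_dist_le y x r K hxK ?_)
    exact ((gridCube hh z).dist_le hy (gridCell_subset_gridCube hh z hxz)).trans hhr
  have hm : ∀ z : Z, MeasurableSet (K ∩ gridCell h z.1) := fun z =>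
    hK.measurableSet.inter (measurableSet_gridCell h _)
  have hd : Pairwise (Function.onFun Disjoint fun z : Z => K ∩ gridCell h z.1) := by
    intro z w hzw
    refine Set.disjoint_left.2 fun x hx hx' => hzw (Subtype.ext (funext fun i => ?_))
    rw [← hx.2 i, ← hx'.2 i]
  conv_lhs => rw [hKe]
  rw [lintegral_iUnion hm hd]
  calc _ ≤ ∑' z : Z, 8 * ENNReal.ofReal h * (ENNReal.ofReal (gridCube hh z.1).side ^ (n - 1) *
        osc f (gridCube hh z.1).carrier) := ENNReal.tsum_le_tsum fun z =>
        lintegral_gridCell_le hn hh j z.1 inter_subset_right (hm z)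
          (hfK.mono_measure (Measure.restrict_mono inter_subset_left le_rfl))
    _ = 8 * ENNReal.ofReal h * ∑' z : Z, ENNReal.ofReal (gridCube hh z.1).side ^ (n - 1) *
        osc f (gridCube hh z.1).carrier := ENNReal.tsum_mul_left
    _ ≤ _ := by
        gcongr
        let c : Z → Fin n → ZMod 4 := fun z i => (z.1 i : ZMod 4)
        rw [← (Equiv.sigmaFiberEquiv c).tsum_eq]
        refine (ENNReal.tsum_sigma (f := fun a (z : {z : Z // c z = a}) =>
          ENNReal.ofReal (gridCube hh z.1.1).side ^ (n - 1) *
            osc f (gridCube hh z.1.1).carrier)).le.trans ?_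
        have hle : ∀ a, ∑' z : {z : Z // c z = a},
            ENNReal.ofReal (gridCube hh z.1.1).side ^ (n - 1) *
              osc f (gridCube hh z.1.1).carrier ≤ Geps (4 * h) f V := fun a => by
          refine tsum_le_Geps f (fun z : {z : Z // c z = a} => gridCube hh z.1.1) ?_
            (fun _ => le_rfl) fun z => hZV z.1
          intro z w hzw
          exact disjoint_gridCube hh (fun h => hzw (Subtype.ext (Subtype.ext h)))
            (z.2.trans w.2.symm)
        refine (ENNReal.tsum_le_tsum hle).trans (le_of_eq ?_)
        rw [tsum_fintype, Finset.sum_const, Finset.card_univ, Fintype.card_fun, ZMod.card,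
          Fintype.card_fin, nsmul_eq_mul]
        push_cast
        rfl

/-- A partial derivative of a test function, tested against `f`, is controlled by `G`. -/
theorem ofReal_integral_mul_fderiv_le (hn : 1 ≤ n) {f : EuclideanSpace ℝ (Fin n) → ℝ}
    {V : Set (EuclideanSpace ℝ (Fin n))} (hV : IsOpen V) (hf : LocallyIntegrableOn f V volume)
    {ψ : EuclideanSpace ℝ (Fin n) → ℝ} (hψ : ContDiff ℝ 1 ψ) (hc : HasCompactSupport ψ)
    (hψV : tsupport ψ ⊆ V) (hψ1 : ∀ x, |ψ x| ≤ 1) (j : Fin n) :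
    ENNReal.ofReal (∫ x, f x * fderiv ℝ ψ x (EuclideanSpace.single j 1)) ≤
      8 * 4 ^ n * G f V := by
  set e : EuclideanSpace ℝ (Fin n) := EuclideanSpace.single j 1 with he
  have hen : ‖e‖ = 1 := by simp [he]
  set K := tsupport ψ with hKdef
  have hK : IsCompact K := hc.isCompact
  obtain ⟨r, hr, hrV⟩ := hK.exists_cthickening_subset_open hV hψV
  have hL : IsCompact (Metric.cthickening r K) := hK.cthickening
  have hiL : IntegrableOn f (Metric.cthickening r K) volume :=
    hf.integrableOn_compact_subset hrV hL
  obtain ⟨C, hC⟩ := hψ.lipschitzWith_of_hasCompactSupport hc one_ne_zero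
  have hn' : (1 : ℝ) ≤ n := by exact_mod_cast hn
  have hsmall : ∀ᶠ h : ℝ in 𝓝[>] 0, 0 < h ∧ n * (4 * h) ≤ r := by
    have h0 : 0 < r / (4 * n) := by positivity
    filter_upwards [Ioc_mem_nhdsGT h0] with h hh
    refine ⟨hh.1, ?_⟩
    have := (le_div_iff₀ (by positivity)).1 hh.2
    linarith
  have hshift : ∀ h : ℝ, 0 < h → n * (4 * h) ≤ r → ∀ x, ψ (x + h • e) ≠ 0 →
      x ∈ Metric.cthickening r K := by
    intro h hh hhr x hx
    refine Metric.mem_cthickening_of_dist_le x (x + h • e) r K (subset_tsupport ψ hx) ?_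
    rw [dist_self_add_right, norm_smul, hen, Real.norm_of_nonneg hh.le]
    nlinarith
  -- Difference quotients of `ψ` are dominated by its Lipschitz constant on a compact thickening of
  -- the support, where `f` is integrable.
  have hlim : Tendsto (fun h : ℝ => ∫ x, f x * (h⁻¹ • (ψ (x + h • e) - ψ x))) (𝓝[>] 0)
      (𝓝 (∫ x, f x * fderiv ℝ ψ x e)) := by
    refine tendsto_integral_filter_of_dominated_convergence
      ((Metric.cthickening r K).indicator fun x => C * ‖f x‖) ?_ ?_
      (IntegrableOn.integrable_indicator (f := fun x => C * ‖f x‖) (hiL.norm.const_mul _)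
        hL.measurableSet) ?_
    · filter_upwards [hsmall] with h hh
      have hcont : Continuous fun x => h⁻¹ • (ψ (x + h • e) - ψ x) := by
        have := hψ.continuous
        fun_prop
      have hsupp : Function.support (fun x => h⁻¹ • (ψ (x + h • e) - ψ x)) ⊆
          Metric.cthickening r K := by
        intro x hx
        by_contra hxL
        have h1 : ψ (x + h • e) = 0 := by
          by_contra h0
          exact hxL (hshift h hh.1 hh.2 x h0)
        have h2 : ψ x = 0 := image_eq_zero_of_notMem_tsupport fun h0 =>
          hxL (Metric.self_subset_cthickening K h0)
        exact hx (by simp [h1, h2])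
      refine (integrable_mul_of_tsupport_subset hf hcont
        (HasCompactSupport.of_support_subset_isCompact hL hsupp) ?_).aestronglyMeasurable
      exact (closure_minimal hsupp hL.isClosed).trans hrV
    · filter_upwards [hsmall] with h hh
      refine ae_of_all _ fun x => ?_
      by_cases hxL : x ∈ Metric.cthickening r K
      · rw [indicator_of_mem hxL, norm_mul, mul_comm]
        refine mul_le_mul_of_nonneg_right ?_ (norm_nonneg _)
        have h1 := hC.dist_le_mul (x + h • e) x
        rw [dist_self_add_left, norm_smul, hen, Real.norm_of_nonneg hh.1.le, mul_one,
          dist_eq_norm] at h1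
        rw [norm_smul, norm_inv, Real.norm_of_nonneg hh.1.le, inv_mul_le_iff₀ hh.1]
        linarith
      · have h1 : ψ (x + h • e) = 0 := by
          by_contra h0
          exact hxL (hshift h hh.1 hh.2 x h0)
        have h2 : ψ x = 0 := image_eq_zero_of_notMem_tsupport fun h0 =>
          hxL (Metric.self_subset_cthickening K h0)
        simp [hxL, h1, h2]
    · refine ae_of_all _ fun x => Tendsto.const_mul _ ?_
      exact ((hψ.differentiable one_ne_zero x).hasFDerivAt.hasLineDerivAt e).tendsto_slope_zero_right
  have hbound : ∀ᶠ h : ℝ in 𝓝[>] 0,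
      ENNReal.ofReal (∫ x, f x * (h⁻¹ • (ψ (x + h • e) - ψ x))) ≤
        8 * 4 ^ n * Geps (4 * h) f V := by
    filter_upwards [hsmall] with h hh
    have hcomp : Continuous fun x => ψ (x + h • e) :=
      hψ.continuous.comp (continuous_id.add continuous_const)
    have hsupp : Function.support (fun x => ψ (x + h • e)) ⊆ Metric.cthickening r K :=
      fun x hx => hshift h hh.1 hh.2 x hx
    have hi1 : Integrable fun x => f x * ψ (x + h • e) :=
      integrable_mul_of_tsupport_subset hf hcomp
        (HasCompactSupport.of_support_subset_isCompact hL hsupp)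
        ((closure_minimal hsupp hL.isClosed).trans hrV)
    have hi2 : Integrable fun x => f x * ψ x :=
      integrable_mul_of_tsupport_subset hf hψ.continuous hc hψV
    have hi3 : Integrable fun x => f (x - h • e) * ψ x := by
      simpa using hi1.comp_sub_right (h • e)
    -- Discrete integration by parts: the difference moves from `ψ` to `f`.
    have heq : ∫ x, f x * (h⁻¹ • (ψ (x + h • e) - ψ x)) =
        h⁻¹ * ∫ x, (f (x - h • e) - f x) * ψ x := by
      calc _ = h⁻¹ * ∫ x, (f x * ψ (x + h • e) - f x * ψ x) := by
            rw [← integral_const_mul]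
            congr 1
            ext x
            simp only [smul_eq_mul]
            ring
        _ = h⁻¹ * ((∫ x, f x * ψ (x + h • e)) - ∫ x, f x * ψ x) := by
            rw [integral_sub hi1 hi2]
        _ = h⁻¹ * ((∫ x, f (x - h • e) * ψ x) - ∫ x, f x * ψ x) := by
            rw [← integral_sub_right_eq_self (fun x => f x * ψ (x + h • e)) (h • e)]
            simp
        _ = _ := by
            rw [← integral_sub hi3 hi2]
            simp only [sub_mul]
    have hle : ENNReal.ofReal (∫ x, (f (x - h • e) - f x) * ψ x) ≤
        8 * ENNReal.ofReal h * (4 ^ n * Geps (4 * h) f V) := by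
      refine (Real.ofReal_le_enorm _).trans ((enorm_integral_le_lintegral_enorm _).trans
        (le_trans ?_ (lintegral_sub_translate_le hn hK hf hrV hh.1 hh.2 j)))
      rw [← lintegral_indicator hK.measurableSet]
      refine lintegral_mono fun x => ?_
      by_cases hx : x ∈ K
      · rw [indicator_of_mem hx, enorm_mul]
        refine mul_le_of_le_one_right' ?_
        rw [← ofReal_norm, Real.norm_eq_abs]
        exact ENNReal.ofReal_le_one.2 (hψ1 x)
      · simp [image_eq_zero_of_notMem_tsupport hx]
    rw [heq, ENNReal.ofReal_mul (inv_nonneg.2 hh.1.le), ENNReal.ofReal_inv_of_pos hh.1]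
    refine (mul_le_mul_right hle _).trans (le_of_eq ?_)
    have hcancel : (ENNReal.ofReal h)⁻¹ * ENNReal.ofReal h = 1 :=
      ENNReal.inv_mul_cancel (by simpa using hh.1) ENNReal.ofReal_ne_top
    calc _ = ((ENNReal.ofReal h)⁻¹ * ENNReal.ofReal h) * (8 * 4 ^ n * Geps (4 * h) f V) := by ring
      _ = _ := by rw [hcancel, one_mul]
  have h4 : Tendsto (fun h : ℝ => 4 * h) (𝓝[>] 0) (𝓝[>] 0) := by
    refine tendsto_nhdsWithin_iff.2 ⟨?_, ?_⟩
    · have : Tendsto (fun h : ℝ => 4 * h) (𝓝 0) (𝓝 (4 * 0)) := tendsto_id.const_mul 4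
      rw [mul_zero] at this
      exact this.mono_left nhdsWithin_le_nhds
    · filter_upwards [self_mem_nhdsWithin] with h hh
      exact mul_pos four_pos (mem_Ioi.1 hh)
  refine le_of_tendsto_of_tendsto ((ENNReal.continuous_ofReal.tendsto _).comp hlim)
    (ENNReal.Tendsto.const_mul ((tendsto_Geps f V).comp h4) (Or.inr ?_)) hbound
  exact ENNReal.mul_ne_top (by simp) (by simp)

/-- The lower bound of `G` by the variation. -/
theorem variation_le_G (hn : 1 ≤ n) {f : EuclideanSpace ℝ (Fin n) → ℝ}
    {V : Set (EuclideanSpace ℝ (Fin n))} (hV : IsOpen V)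
    (hf : LocallyIntegrableOn f V volume) :
    variation f V ≤ n * (8 * 4 ^ n) * G f V := by
  refine iSup₂_le fun φ hφ => ?_
  rw [setIntegral_test f hφ.tsupport_subset]
  have hcoord : ∀ i, ContDiff ℝ 1 fun x => φ x i := fun i => by
    have := hφ.contDiff
    fun_prop
  have hsupp : ∀ i, tsupport (fun x => φ x i) ⊆ tsupport φ := fun i =>
    closure_mono fun x hx h0 => hx (by simp [h0])
  have hcs : ∀ i, HasCompactSupport fun x => φ x i := fun i =>
    HasCompactSupport.of_support_subset_isCompact hφ.hasCompactSupport.isCompact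
      ((subset_tsupport _).trans (hsupp i))
  have hdiv : ∀ x, f x * divergence φ x =
      ∑ i, f x * fderiv ℝ (fun x => φ x i) x (EuclideanSpace.single i 1) := fun x => by
    rw [divergence, Finset.mul_sum]
    refine Finset.sum_congr rfl fun i _ => ?_
    have h1 : HasFDerivAt φ (fderiv ℝ φ x) x :=
      (hφ.contDiff.differentiable one_ne_zero x).hasFDerivAt
    have h2 := ((EuclideanSpace.proj (𝕜 := ℝ) i).hasFDerivAt (x := φ x)).comp x h1
    have h3 : HasFDerivAt (fun x => φ x i)
      ((EuclideanSpace.proj (𝕜 := ℝ) i).comp (fderiv ℝ φ x)) x := h2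
    rw [h3.fderiv]
    rfl
  have hint : ∀ i, Integrable fun x =>
      f x * fderiv ℝ (fun x => φ x i) x (EuclideanSpace.single i 1) := fun i => by
    have hs : tsupport (fun x => fderiv ℝ (fun x => φ x i) x (EuclideanSpace.single i 1)) ⊆
        tsupport fun x => φ x i := by
      refine closure_minimal (fun x hx => support_fderiv_subset ℝ fun h0 => hx ?_)
        (isClosed_tsupport _)
      simp [h0]
    exact integrable_mul_of_tsupport_subset hf
      (((hcoord i).continuous_fderiv one_ne_zero).clm_apply continuous_const)
      (HasCompactSupport.of_support_subset_isCompact (hcs i).isCompact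
        ((subset_tsupport _).trans hs)) (hs.trans ((hsupp i).trans hφ.tsupport_subset))
  simp only [hdiv]
  rw [integral_finsetSum _ fun i _ => hint i]
  calc _ ≤ ∑ i, ENNReal.ofReal
        (∫ x, f x * fderiv ℝ (fun x => φ x i) x (EuclideanSpace.single i 1)) :=
        Finset.le_sum_of_subadditive ENNReal.ofReal ENNReal.ofReal_zero.le
          (fun _ _ => ENNReal.ofReal_add_le) _ _
    _ ≤ ∑ _i : Fin n, 8 * 4 ^ n * G f V := Finset.sum_le_sum fun i _ =>
        ofReal_integral_mul_fderiv_le hn hV hf (hcoord i) (hcs i)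
          ((hsupp i).trans hφ.tsupport_subset)
          (fun x => (PiLp.norm_apply_le (φ x) i).trans (hφ.norm_le_one x)) i
    _ = _ := by simp [mul_assoc]

/-! ### Inner regularity and countable subadditivity -/

/-- A nearly optimal test field has compact support, hence is admissible in a relatively compact
neighbourhood of it. -/
theorem exists_relcompact_lt_variation {f : EuclideanSpace ℝ (Fin n) → ℝ}
    {U : Set (EuclideanSpace ℝ (Fin n))} (hU : IsOpen U) {a : ℝ≥0∞} (ha : a < variation f U) :
    ∃ V, IsOpen V ∧ IsCompact (closure V) ∧ closure V ⊆ U ∧ a < variation f V := by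
  obtain ⟨φ, hφ⟩ := lt_iSup_iff.1 ha
  obtain ⟨ht, hlt⟩ := lt_iSup_iff.1 hφ
  obtain ⟨V, hV, hKV, hVU, hVc⟩ := exists_open_between_and_isCompact_closure
    ht.hasCompactSupport.isCompact hU ht.tsupport_subset
  refine ⟨V, hV, hVc, hVU, hlt.trans_le ?_⟩
  rw [setIntegral_test f ht.tsupport_subset, ← setIntegral_test f hKV]
  exact le_iSup₂_of_le φ ⟨ht.contDiff, ht.hasCompactSupport, hKV, ht.norm_le_one⟩ le_rfl

/-- A small cube either meets `K`, and then lies in `V`, or avoids `K`. -/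
theorem G_le_add_of_isCompact {f : EuclideanSpace ℝ (Fin n) → ℝ}
    {K U V : Set (EuclideanSpace ℝ (Fin n))} (hK : IsCompact K) (hV : IsOpen V) (hKV : K ⊆ V) :
    G f U ≤ G f V + G f (U \ K) := by
  obtain ⟨r, hr, hrV⟩ := hK.exists_cthickening_subset_open hV hKV
  have hn : (0 : ℝ) < n + 1 := by positivity
  have h := G_le_sum (ε := r / (n + 1)) (div_pos hr hn) f (U := U) Finset.univ
    (fun b : Bool => if b then V else U \ K) ?_
  · simpa using h
  intro Q hQ hQU
  by_cases hx : ∃ x ∈ Q.carrier, x ∈ K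
  · obtain ⟨x, hxQ, hxK⟩ := hx
    refine ⟨true, Finset.mem_univ _, fun y hy => hrV ?_⟩
    refine Metric.mem_cthickening_of_dist_le y x r K hxK ((Q.dist_le hy hxQ).trans ?_)
    rw [le_div_iff₀ hn] at hQ
    nlinarith [Q.side_pos]
  · push Not at hx
    exact ⟨false, Finset.mem_univ _, fun y hy => ⟨hQU hy, hx y hy⟩⟩

/-- Inner regularity of `G` on open sets. -/
theorem G_le_of_forall_relcompact (hn : 1 ≤ n) {f : EuclideanSpace ℝ (Fin n) → ℝ}
    {U : Set (EuclideanSpace ℝ (Fin n))} (hU : IsOpen U) (hf : LocallyIntegrableOn f U volume)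
    {B : ℝ≥0∞} (hB : ∀ V, IsOpen V → IsCompact (closure V) → closure V ⊆ U → G f V ≤ B) :
    G f U ≤ B := by
  have hn0 : (n : ℝ≥0∞) ≠ 0 := by simpa using (by omega : n ≠ 0)
  -- Infinite variation is possible, since `U` need not be relatively compact in `Ω`. The lower
  -- bound then forces `B = ∞`.
  rcases eq_or_ne (variation f U) ∞ with hv | hv
  · have hC : (n * (8 * 4 ^ n) : ℝ≥0∞) ≠ ∞ :=
      ENNReal.mul_ne_top (by simp) (ENNReal.mul_ne_top (by simp) (by simp))
    have htop : (n * (8 * 4 ^ n) : ℝ≥0∞) * B = ∞ := by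
      by_contra hne
      obtain ⟨V, hVo, hVc, hVU, hlt⟩ := exists_relcompact_lt_variation hU
        (hv ▸ lt_top_iff_ne_top.2 hne)
      refine hlt.not_ge ((variation_le_G hn hVo
        (hf.mono_set (subset_closure.trans hVU))).trans ?_)
      gcongr
      exact hB V hVo hVc hVU
    have : B = ∞ := by
      by_contra hne
      exact ENNReal.mul_ne_top hC hne htop
    rw [this]
    exact le_top
  rcases eq_or_ne (variation f U) 0 with h0 | h0
  · have := G_le_variation hn hf
    rw [h0, mul_zero] at this
    exact this.trans zero_le
  refine ENNReal.le_of_forall_pos_le_add fun ε hε _ => ?_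
  set C : ℝ≥0∞ := 2 ^ n * n with hC
  have hC0 : C ≠ 0 := by positivity
  have hCt : C ≠ ∞ := ENNReal.mul_ne_top (by simp) (by simp)
  have hη : (ε : ℝ≥0∞) / C ≠ 0 := by
    simp [ENNReal.div_eq_zero_iff, hε.ne', hCt]
  -- `V` captures all but `ε / C` of the variation, so superadditivity leaves at most `ε / C`
  -- outside `closure V`. The set `W` is a buffer for the cubes that meet `closure V`.
  obtain ⟨V, hVo, hVc, hVU, hlt⟩ :=
    exists_relcompact_lt_variation hU (ENNReal.sub_lt_self hv h0 hη)
  obtain ⟨W, hWo, hVW, hWU, hWc⟩ := exists_open_between_and_isCompact_closure hVc hU hVU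
  have hsup := variation_superadd f (disjoint_sdiff_right.mono_left subset_closure :
    Disjoint V (U \ closure V)) (subset_closure.trans hVU) sdiff_subset
  have hsmall : variation f (U \ closure V) ≤ ε / C := by
    have h1 : variation f U ≤ variation f V + ε / C := tsub_le_iff_right.1 hlt.le
    have h2 := hsup.trans h1
    refine (ENNReal.add_le_add_iff_left ?_).1 h2
    exact ne_top_of_le_ne_top hv (le_self_add.trans hsup)
  calc G f U ≤ G f W + G f (U \ closure V) := G_le_add_of_isCompact hVc hWo hVW
    _ ≤ B + C * (ε / C) := by
        refine add_le_add (hB W hWo hWc hWU) ?_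
        refine (G_le_variation hn (hf.mono_set sdiff_subset)).trans ?_
        gcongr
    _ ≤ B + ε := by
        gcongr
        exact ENNReal.mul_div_le

theorem G_iUnion_le (hn : 1 ≤ n) {f : EuclideanSpace ℝ (Fin n) → ℝ}
    (U : ℕ → Set (EuclideanSpace ℝ (Fin n))) (hU : ∀ i, IsOpen (U i))
    (hf : LocallyIntegrableOn f (⋃ i, U i) volume) :
    G f (⋃ i, U i) ≤ ∑' i, G f (U i) :=
  G_le_of_forall_relcompact hn (isOpen_iUnion hU) hf fun _ _ hVc hVU =>
    G_le_tsum_of_closure_subset f hVc U hU hVU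

/-! ### The measure generated by `G` and its domination by `|Df|` -/

/-- The outer measure on `Ω` generated by `G` on the relatively open subsets of `Ω`. -/
noncomputable def GOuter (f : EuclideanSpace ℝ (Fin n) → ℝ)
    (Ω : Set (EuclideanSpace ℝ (Fin n))) : OuterMeasure Ω :=
  inducedOuterMeasure (fun (U : Set Ω) (_ : IsOpen U) => G f (Subtype.val '' U))
    isOpen_empty (by simp [G_empty])

section

variable {f : EuclideanSpace ℝ (Fin n) → ℝ} {Ω : Set (EuclideanSpace ℝ (Fin n))}

theorem G_image_iUnion_le (hn : 1 ≤ n) (hΩ : IsOpen Ω) (hf : LocallyIntegrableOn f Ω volume)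
    ⦃U : ℕ → Set Ω⦄ (hU : ∀ i, IsOpen (U i)) :
    G f (Subtype.val '' ⋃ i, U i) ≤ ∑' i, G f (Subtype.val '' U i) := by
  rw [image_iUnion]
  exact G_iUnion_le hn _ (fun i => hΩ.isOpenMap_subtype_val _ (hU i))
    (hf.mono_set (iUnion_subset fun i => Subtype.coe_image_subset Ω (U i)))

theorem GOuter_apply_of_isOpen (hn : 1 ≤ n) (hΩ : IsOpen Ω)
    (hf : LocallyIntegrableOn f Ω volume) {U : Set Ω} (hU : IsOpen U) :
    GOuter f Ω U = G f (Subtype.val '' U) :=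
  inducedOuterMeasure_eq' (fun _ h => isOpen_iUnion h) (G_image_iUnion_le hn hΩ hf)
    (fun _ _ _ _ h => G_mono f (image_mono h)) hU

/-- Sets at positive distance have disjoint open neighbourhoods, and `G` is superadditive on the
traces of these in any open superset of the union. Borel sets are therefore Carathéodory measurable.
-/
theorem GOuter_isMetric (hn : 1 ≤ n) (hΩ : IsOpen Ω) (hf : LocallyIntegrableOn f Ω volume) :
    (GOuter f Ω).IsMetric := by
  intro s t hst
  refine le_antisymm (measure_union_le s t) ?_
  obtain ⟨r, r0, hr⟩ := hst
  have hr2 : 0 < r / 2 := ENNReal.half_pos r0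
  set S : Set Ω := ⋃ x ∈ s, Metric.eball x (r / 2) with hS
  set T : Set Ω := ⋃ x ∈ t, Metric.eball x (r / 2) with hT
  have hSo : IsOpen S := isOpen_biUnion fun _ _ => Metric.isOpen_eball
  have hTo : IsOpen T := isOpen_biUnion fun _ _ => Metric.isOpen_eball
  have hsS : s ⊆ S := fun x hx => mem_biUnion hx (Metric.mem_eball_self hr2)
  have htT : t ⊆ T := fun x hx => mem_biUnion hx (Metric.mem_eball_self hr2)
  have hdis : Disjoint S T := by
    rw [Set.disjoint_left]
    intro z hz hz'
    obtain ⟨x, hx, hxz⟩ := mem_iUnion₂.1 hz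
    obtain ⟨y, hy, hyz⟩ := mem_iUnion₂.1 hz'
    rw [Metric.mem_eball] at hxz hyz
    have : edist x y < r := by
      calc edist x y ≤ edist x z + edist z y := edist_triangle _ _ _
        _ < r / 2 + r / 2 := ENNReal.add_lt_add (by rwa [edist_comm]) hyz
        _ = r := ENNReal.add_halves r
    exact absurd (hr x hx y hy) (not_le.2 this)
  conv_rhs => rw [GOuter, inducedOuterMeasure_eq_iInf (fun _ h => isOpen_iUnion h)
    (G_image_iUnion_le hn hΩ hf) (fun _ _ _ _ h => G_mono f (image_mono h))]
  refine le_iInf₂ fun O hO => le_iInf fun hstO => ?_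
  have hle : ∀ (A B : Set Ω), IsOpen B → A ⊆ B → A ⊆ O →
      GOuter f Ω A ≤ G f (Subtype.val '' (O ∩ B)) := fun A B hB hAB hAO =>
    (measure_mono (subset_inter hAO hAB)).trans
      (GOuter_apply_of_isOpen hn hΩ hf (hO.inter hB)).le
  refine (add_le_add (hle s S hSo hsS (subset_union_left.trans hstO))
    (hle t T hTo htT (subset_union_right.trans hstO))).trans ?_
  refine G_superadd f ?_ (image_mono inter_subset_left) (image_mono inter_subset_left)
  rw [disjoint_image_iff Subtype.val_injective]
  exact hdis.mono inter_subset_right inter_subset_right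

theorem GOuter_le (hn : 1 ≤ n) (hΩ : IsOpen Ω) (hf : LocallyIntegrableOn f Ω volume)
    (s : Set Ω) : GOuter f Ω s ≤ 2 ^ n * n * totalVarOuter f Ω s := by
  have hn0 : (n : ℝ≥0∞) ≠ 0 := by simpa using (by omega : n ≠ 0)
  have hC0 : (2 ^ n * n : ℝ≥0∞) ≠ 0 := by positivity
  have hCt : (2 ^ n * n : ℝ≥0∞) ≠ ∞ := ENNReal.mul_ne_top (by simp) (by simp)
  -- `totalVarOuter` is the largest outer measure below the variation on open sets, so the constant
  -- is moved to the left and only open sets need checking.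
  have hle : ((2 ^ n * n : ℝ≥0∞)⁻¹) • GOuter f Ω ≤ totalVarOuter f Ω := by
    refine le_inducedOuterMeasure.2 fun U hU => ?_
    rw [smul_apply, smul_eq_mul, GOuter_apply_of_isOpen hn hΩ hf hU,
      ENNReal.inv_mul_le_iff hC0 hCt]
    exact G_le_variation hn (hf.mono_set (Subtype.coe_image_subset Ω U))
  have := hle s
  rwa [smul_apply, smul_eq_mul, ENNReal.inv_mul_le_iff hC0 hCt] at this

/-- The only place where finiteness of the variation on relatively compact sets enters. -/
theorem totalVar_isLocallyFinite (hΩ : IsOpen Ω) (hf : IsBVLoc f Ω) :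
    IsLocallyFiniteMeasure (totalVar f Ω) := by
  refine ⟨fun x => ?_⟩
  obtain ⟨V, hV, hxV, hVΩ, hVc⟩ := exists_open_between_and_isCompact_closure
    (isCompact_singleton (x := (x : EuclideanSpace ℝ (Fin n)))) hΩ (by simp)
  have hVo : IsOpen ((↑) ⁻¹' V : Set Ω) := hV.preimage continuous_subtype_val
  refine ⟨(↑) ⁻¹' V, hVo.mem_nhds (by simpa using hxV), ?_⟩
  rw [totalVar, toMeasure_apply _ _ hVo.measurableSet]
  refine (le_inducedOuterMeasure.1 le_rfl _ hVo).trans_lt ?_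
  rw [Subtype.image_preimage_coe, inter_eq_self_of_subset_right (subset_closure.trans hVΩ)]
  exact hf.variation_lt_top V hV hVc hVΩ

end

end BVOsc

/-! ### The main theorem -/

theorem proposition2p1 (n : ℕ) (hn : 1 ≤ n) (Ω : Set (EuclideanSpace ℝ (Fin n)))
    (hΩ : IsOpen Ω) (f : EuclideanSpace ℝ (Fin n) → ℝ) (hf : BVOsc.IsBVLoc f Ω) :
    ∃ μ : Measure Ω,
      μ.Regular ∧
      (∀ U : Set Ω, IsOpen U → μ U = BVOsc.G f (Subtype.val '' U)) ∧
      μ ≪ BVOsc.totalVar f Ω ∧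
      ∃ g : Ω → ℝ≥0, Measurable g ∧
        ∀ B : Set Ω, MeasurableSet B → μ B = ∫⁻ x in B, (g x : ℝ≥0∞) ∂(BVOsc.totalVar f Ω) := by
  have hfi := hf.locallyIntegrableOn
  let μ : Measure Ω :=
    (BVOsc.GOuter f Ω).toMeasure (BVOsc.GOuter_isMetric hn hΩ hfi).le_caratheodory
  have hle : μ ≤ (2 ^ n * n : ℝ≥0∞) • BVOsc.totalVar f Ω := by
    refine Measure.le_iff.2 fun s hs => ?_
    rw [Measure.smul_apply, smul_eq_mul, BVOsc.totalVar, toMeasure_apply _ _ hs,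
      toMeasure_apply _ _ hs]
    exact BVOsc.GOuter_le hn hΩ hfi s
  have hac : μ ≪ BVOsc.totalVar f Ω := Measure.absolutelyContinuous_of_le_smul hle
  have hlf : IsLocallyFiniteMeasure (BVOsc.totalVar f Ω) :=
    BVOsc.totalVar_isLocallyFinite hΩ hf
  have hlfμ : IsLocallyFiniteMeasure μ := by
    refine ⟨fun x => ?_⟩
    obtain ⟨s, hs, hlt⟩ := (BVOsc.totalVar f Ω).finiteAt_nhds x
    refine ⟨s, hs, (hle s).trans_lt ?_⟩
    rw [Measure.smul_apply, smul_eq_mul]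
    exact ENNReal.mul_lt_top (ENNReal.mul_lt_top (by simp) (by simp)) hlt
  -- With local compactness of `Ω`, local finiteness of `μ` gives regularity.
  have : LocallyCompactSpace Ω := hΩ.locallyCompactSpace
  refine ⟨μ, inferInstance, fun U hU => ?_, hac,
    fun x => (μ.rnDeriv (BVOsc.totalVar f Ω) x).toNNReal,
    (Measure.measurable_rnDeriv _ _).ennreal_toNNReal, fun B hB => ?_⟩
  · rw [toMeasure_apply _ _ hU.measurableSet]
    exact BVOsc.GOuter_apply_of_isOpen hn hΩ hfi hU
  · rw [← Measure.setLIntegral_rnDeriv hac B]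
    -- The derivative is finite almost everywhere, so truncating it to `ℝ≥0` does not change the
    -- integral.
    refine lintegral_congr_ae (ae_restrict_of_ae ?_)
    filter_upwards [μ.rnDeriv_lt_top (BVOsc.totalVar f Ω)] with x hx
    exact (ENNReal.coe_toNNReal hx.ne).symm
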